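/- Let $(\varphi_t)_{t\ge 0}$ be a measurable flow on a measurable space $\mathcal M$ (that is, $\varphi_0=\mathrm{id}$, $\varphi_{s+t}=\varphi_s\circ\varphi_t$ for $s,t\ge 0$, and $(t,\omega)\mapsto\varphi_t(\omega)$ is measurable) preserving a $\sigma$-finite measure $\nu$ with $\nu(\mathcal M)=\infty$, and assume that $(\mathcal M,\varphi,\nu)$ is conservative and ergodic. Say that a family of random variables $(U^\epsilon)_{\epsilon>0}$ on $\mathcal M$ converges strongly in distribution (with respect to $\nu$) to $U$ as $\epsilon\to0^+$ if, under every probability measure absolutely continuous with respect to $\nu$, $U^\epsilon$ converges in distribution to $U$. Let $(\mathfrak a_\epsilon)_{\epsilon>0}$ be a family of positive numbers and $(Z_t)_{t\ge0}$ a real stochastic process, on some probability space, with continuous nondecreasing paths, such that for every $g\in L^1(\nu)$ and every $T>0$ $$\Big(\mathfrak a_\epsilon\int_0^{t/\epsilon}g\circ\varphi_s\,ds\Big)_{t\in[0,T]}\ \longrightarrow\ \Big(\int_{\mathcal M}g\,d\nu\; Z_t\Big)_{t\in[0,T]}\qquad(\epsilon\to0^+)$$ strongly in distribution, in $C([0,T],\mathbb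 R)$ with the uniform norm. Let $f:\mathbb R^d\times\mathcal M\to\mathbb R^d$ and $\bar f:\mathbb R^d\to\mathbb R^d$ be bounded measurable maps such that $f(\cdot,\omega)$ ($\omega\in\mathcal M$) and $\bar f$ are twice differentiable with derivatives of order $1$ and $2$ bounded (uniformly in $\omega$). Assume that $f(y,\cdot)$ is $\nu$-integrable for every $y\in\mathbb R^d$, and that the Lipschitz constants of $f(\cdot,\omega)$ and of $D_1f(\cdot,\omega)$ are $\nu$-integrable functions of $\omega$. Fix $x\in\mathbb R^d$, let $W$ be the solution on $[0,\infty)$ of $\frac{d}{dt}W_t=\bar f(W_t)$, $W_0=x$, and, for $\epsilon>0$ and $\omega\in\mathcal M$, let $X^\epsilon(\omega)$ be the (absolutely continuous) solution on $[0,\infty)$ of $$\frac{d}{dt}X^\epsilon_t(\omega)=f\big(X^\epsilon_t(\omega),\varphi_{t/\epsilon}(\omega)\big)+\bar f\big(X^\epsilon_t(\omega)\big),\qquad X^\epsilon_0(\omega)=x .$$ Put $E^\epsilon_t=X^\epsilon_t-W_t$, $h(y)=\int_{\mathcal M}f(y,\cdot)\,d\nu$ and $\tilde V_t=\int_0^t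 h(W_s)\,dZ_s$ (pathwise Stieltjes integral). Then $\big(\frac{\mathfrak a_\epsilon}{\epsilon}E^\epsilon_t\big)_{t\ge0}$ converges strongly in distribution with respect to $\nu$, as $\epsilon\to0^+$, in $C([0,\infty),\mathbb R^d)$ with the topology of uniform convergence on compact intervals, to the continuous process $(\tilde Y_t)_{t\ge0}$ that solves $d\tilde Y_t=h(W_t)\,dZ_t+D\bar f(W_t)\tilde Y_t\,dt$, $\tilde Y_0=0$, i.e. $$\tilde Y_t=\tilde V_t+\int_0^tD\bar f(W_s)\,\tilde Y_s\,ds,\qquad t\ge0.$$ If the matrices $D\bar f(W_s)$, $s\ge0$, commute pairwise (in particular if $d=1$), this process is given explicitly by $$\tilde Y_t=\tilde V_t+\int_0^tD\bar f(W_s)\exp\Big(\int_s^tD\bar f(W_u)\,du\Big)\tilde V_s\,ds .$$ -/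

import Mathlib

open MeasureTheory Filter Topology Set
open scoped NNReal

/-- Spaces of continuous maps (with the compact-open topology, that is, uniform convergence on
compact sets) carry their Borel σ-algebra. -/
instance continuousMapMeasurableSpace {S E : Type*} [TopologicalSpace S] [TopologicalSpace E] :
    MeasurableSpace C(S, E) := borel _

instance continuousMapBorelSpace {S E : Type*} [TopologicalSpace S] [TopologicalSpace E] :
    BorelSpace C(S, E) := ⟨rfl⟩

/-- A function of time, seen as an element of the path space `C([0,∞), E)`
(the zero path if the function is not continuous on `[0,∞)`). -/
noncomputable def toPath {E : Type*} [TopologicalSpace E] [Zero E] (u : ℝ → E) : C(ℝ≥0, E) :=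
  ContinuousMap.mkD (fun t : ℝ≥0 => u (t : ℝ)) 0

/-- The restriction of a path to the time interval `[0,T]`, an element of `C([0,T], E)`. -/
def restrictPath {E : Type*} [TopologicalSpace E] (T : ℝ≥0) (u : C(ℝ≥0, E)) :
    C(Set.Icc (0 : ℝ≥0) T, E) :=
  u.restrict (Set.Icc 0 T)

/-- Strong convergence in distribution with respect to `ν`, as `ε → 0+`: convergence in
distribution with respect to every probability measure absolutely continuous with respect
to `ν`. -/
def StrongTendstoInDistribution {M Ω E : Type*} [MeasurableSpace M] [MeasurableSpace Ω]
    [TopologicalSpace E] [MeasurableSpace E] [OpensMeasurableSpace E]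
    (ν : Measure M) (X : Set.Ioi (0 : ℝ) → M → E)
    (Y : Ω → E) (ℙ : Measure Ω) [IsProbabilityMeasure ℙ] : Prop :=
  ∀ (P : Measure M) [IsProbabilityMeasure P], P ≪ ν →
    TendstoInDistribution X (comap Subtype.val (𝓝 (0 : ℝ))) Y (fun _ => P) ℙ

/-- A measurable flow `(φ_t)_{t ≥ 0}`; the values of `φ` at negative times are irrelevant. -/
structure IsMeasurableFlow {M : Type*} [MeasurableSpace M] (φ : ℝ → M → M) : Prop where
  zero : ∀ ω, φ 0 ω = ω
  add : ∀ s t, 0 ≤ s → 0 ≤ t → ∀ ω, φ (s + t) ω = φ s (φ t ω)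
  measurable : Measurable fun p : ℝ≥0 × M => φ (p.1 : ℝ) p.2

/-- Conservativity: almost every point of a measurable set returns to it at arbitrarily large
times. -/
def IsConservativeFlow {M : Type*} [MeasurableSpace M] (φ : ℝ → M → M) (ν : Measure M) : Prop :=
  ∀ A : Set M, MeasurableSet A → ∀ᵐ ω ∂ν, ω ∈ A → ∃ᶠ t in atTop, φ t ω ∈ A

/-- Ergodicity: invariant measurable sets are null or conull. -/
def IsErgodicFlow {M : Type*} [MeasurableSpace M] (φ : ℝ → M → M) (ν : Measure M) : Prop :=
  ∀ A : Set M, MeasurableSet A → (∀ t, 0 ≤ t → φ t ⁻¹' A = A) → ν A = 0 ∨ ν Aᶜ = 0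

/-- `y` is the (absolutely continuous) solution on `[0,∞)` of `dy/dt = F t y`, `y 0 = x`. -/
def IsSolution {E : Type*} [NormedAddCommGroup E] [NormedSpace ℝ E]
    (F : ℝ → E → E) (x : E) (y : ℝ → E) : Prop :=
  ContinuousOn y (Ici 0) ∧ ∀ t, 0 ≤ t → y t = x + ∫ s in (0 : ℝ)..t, F s (y s)

/-- The best Lipschitz constant of `g`, if `g` is Lipschitz. -/
noncomputable def lipConst {E F : Type*} [NormedAddCommGroup E] [NormedAddCommGroup F]
    (g : E → F) : ℝ :=
  sInf {K : ℝ | 0 ≤ K ∧ ∀ x y, ‖g x - g y‖ ≤ K * ‖x - y‖}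

/-- The map `g` is twice differentiable, and `g` and its derivatives of first and second orders are
all bounded by `C`. -/
structure TwiceDiffBounded {E : Type*} [NormedAddCommGroup E] [NormedSpace ℝ E]
    (g : E → E) (C : ℝ) : Prop where
  differentiable : Differentiable ℝ g
  differentiable_fderiv : Differentiable ℝ (fderiv ℝ g)
  bound : ∀ x, ‖g x‖ ≤ C
  bound_fderiv : ∀ x, ‖fderiv ℝ g x‖ ≤ C
  bound_fderiv_fderiv : ∀ x, ‖fderiv ℝ (fderiv ℝ g) x‖ ≤ C

/-- A continuous nondecreasing function on `[0,∞)`, extended by its value at `0` to negative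
times, as a Stieltjes function. -/
noncomputable def increasingStieltjes (z : ℝ → ℝ) (hc : ContinuousOn z (Ici 0))
    (hm : MonotoneOn z (Ici 0)) : StieltjesFunction ℝ where
  toFun s := z (max s 0)
  mono' s t h := hm (mem_Ici.2 (le_max_right s 0)) (mem_Ici.2 (le_max_right t 0))
    (max_le_max_right 0 h)
  right_continuous' _ := by
    have h : Continuous fun s : ℝ => z (max s 0) :=
      hc.comp_continuous (continuous_id.max continuous_const) fun s => le_max_right s 0
    exact h.continuousWithinAt

/-- The Lebesgue–Stieltjes integral `∫_0^t u_s dz_s` against a continuous nondecreasing `z`. -/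
noncomputable def stieltjesIntegral {E : Type*} [NormedAddCommGroup E] [NormedSpace ℝ E]
    (u : ℝ → E) (z : ℝ → ℝ) (hc : ContinuousOn z (Ici 0)) (hm : MonotoneOn z (Ici 0))
    (t : ℝ) : E :=
  ∫ s in Ioc 0 t, u s ∂(increasingStieltjes z hc hm).measure

/-!
Write `b = a ε / ε` and `E = X - W`, and fix a probability measure `P ≪ ν`. The rescaled error
`y = b E` is the solution of a linear Volterra equation `y_t = N_t + ∫_0^t Dfbar(W_s) y_s ds` whose
driving term `N` is `b ∫_0^t f(W_s, φ_{s/ε}) ds` up to a remainder. The solution map `N ↦ y` is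
continuous for locally uniform convergence (`continuous_volterraSolution`, from Grönwall's
inequality), so that it suffices to show that `N` converges in distribution to
`V_t = ∫_0^t h(W_s) dZ_s`.

The remainder is at most a constant times `S² / b`, where `S` is the rescaled occupation integral of
an integrable function that dominates `f` along `W` and the Lipschitz constants of `f`
(`norm_remainder_le_of_perturbed`). It vanishes in the limit: if `b → ∞`, because `S` is tight; and
otherwise because then `Z_T ≤ 0` almost surely, so that `S → 0` in probability. The latter uses that
`ν` is infinite: the occupation integral of an indicator function up to time `T` is at most `b T`,
so that `ν(A) Z_T` is bounded uniformly in `A` (`FunctionalLLN.tendsto_measure_sq_div`).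

To pass to the limit in `b ∫_0^t f(W_s, φ_{s/ε}) ds`, the integrand is frozen on a grid of mesh
`1/n`. The functional law of large numbers, applied to functions of integral zero, shows that the
occupation integrals of all integrable functions are asymptotically proportional to those of one
function `g` of integral `1`, so that no joint convergence is needed
(`FunctionalLLN.tendsto_measure_norm_sub`). Hence `N` is close to a Riemann–Stieltjes sum with
respect to the occupation path of `g` (`FunctionalLLN.eventually_measure_le`). This sum is a
continuous functional of the path, which converges in distribution to `Z`; and the sums with
respect to `Z` converge to `V` as `n → ∞`. The limits in `ε` and in `n` are exchanged by
`tendstoInDistribution_path_of_approx`.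

The law of the rescaled error makes sense because the solutions depend measurably on `ω`, as limits
of Picard iterates (`measurable_isSolution`), and because a random path with measurable values is a
measurable map into the path space (`measurable_path_of_eval`).

If the operators `Dfbar(W_s)` commute, the exponential of their integral is the resolvent of the
linear equation, which gives the explicit formula (`volterraSolution_eq_of_commute`).
-/

open scoped ENNReal

/-! ### Convergence in distribution -/

/-- The portmanteau inequality for open sets, for random variables. -/
theorem le_of_tendstoInDistribution_of_isOpen {ι M Ω E : Type*} [MeasurableSpace M]
    [MeasurableSpace Ω] [TopologicalSpace E] [MeasurableSpace E] [OpensMeasurableSpace E]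
    [HasOuterApproxClosed E]
    {l : Filter ι} {P : Measure M} [IsProbabilityMeasure P] {ℙ : Measure Ω}
    [IsProbabilityMeasure ℙ] {X : ι → M → E} {Y : Ω → E}
    (h : TendstoInDistribution X l Y (fun _ => P) ℙ) {G : Set E} (hG : IsOpen G) :
    ℙ (Y ⁻¹' G) ≤ l.liminf fun i => P (X i ⁻¹' G) := by
  have := ProbabilityMeasure.le_liminf_measure_open_of_tendsto h.tendsto hG
  simp only [ProbabilityMeasure.coe_mk] at this
  rw [Measure.map_apply_of_aemeasurable h.aemeasurable_limit hG.measurableSet] at this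
  simpa only [Measure.map_apply_of_aemeasurable (h.forall_aemeasurable _) hG.measurableSet]
    using this

/-- The portmanteau inequality for closed sets, for random variables. -/
theorem limsup_le_of_tendstoInDistribution_of_isClosed {ι M Ω E : Type*} [MeasurableSpace M]
    [MeasurableSpace Ω] [TopologicalSpace E] [MeasurableSpace E] [OpensMeasurableSpace E]
    [HasOuterApproxClosed E]
    {l : Filter ι} {P : Measure M} [IsProbabilityMeasure P] {ℙ : Measure Ω}
    [IsProbabilityMeasure ℙ] {X : ι → M → E} {Y : Ω → E}
    (h : TendstoInDistribution X l Y (fun _ => P) ℙ) {F : Set E} (hF : IsClosed F) :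
    (l.limsup fun i => P (X i ⁻¹' F)) ≤ ℙ (Y ⁻¹' F) := by
  have := ProbabilityMeasure.limsup_measure_closed_le_of_tendsto h.tendsto hF
  simp only [ProbabilityMeasure.coe_mk] at this
  rw [Measure.map_apply_of_aemeasurable h.aemeasurable_limit hF.measurableSet] at this
  simpa only [Measure.map_apply_of_aemeasurable (h.forall_aemeasurable _) hF.measurableSet]
    using this

/-- If `X i` is close in probability to `X' n i` for large `n`, uniformly in the limit of `i`, if
`X' n i` converges in distribution to `Y' n` for every `n`, and if `Y' n` converges pointwise to
`Y`, then `X i` converges in distribution to `Y`. -/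
theorem tendstoInDistribution_of_approx {ι M Ω E : Type*} [MeasurableSpace M]
    [MeasurableSpace Ω] [PseudoMetricSpace E] [MeasurableSpace E] [BorelSpace E]
    {l : Filter ι} [l.IsCountablyGenerated] {P : Measure M} [IsProbabilityMeasure P]
    {ℙ : Measure Ω} [IsProbabilityMeasure ℙ] {X : ι → M → E} {Y : Ω → E}
    {X' : ℕ → ι → M → E} {Y' : ℕ → Ω → E} (hX : ∀ i, AEMeasurable (X i) P)
    (h : ∀ n, TendstoInDistribution (X' n) l (Y' n) (fun _ => P) ℙ)
    (hY : ∀ ω, Tendsto (fun n => Y' n ω) atTop (𝓝 (Y ω)))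
    (happrox : ∀ η : ℝ, 0 < η → ∀ δ : ℝ≥0∞, 0 < δ →
      ∀ᶠ n in atTop, ∀ᶠ i in l, P {ω | η ≤ dist (X i ω) (X' n i ω)} ≤ δ) :
    TendstoInDistribution X l Y (fun _ => P) ℙ := by
  have hYm : AEMeasurable Y ℙ :=
    aemeasurable_of_tendsto_metrizable_ae atTop (fun n => (h n).aemeasurable_limit)
      (ae_of_all _ hY)
  have hYY := tendstoInDistribution_of_ae_tendsto (fun n => (h n).aemeasurable_limit) hYm
    (ae_of_all _ hY)
  refine ⟨hX, hYm, tendsto_of_forall_isClosed_limsup_le' fun F hF => ?_⟩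
  simp only [ProbabilityMeasure.coe_mk]
  rw [Measure.map_apply_of_aemeasurable hYm hF.measurableSet]
  simp only [Measure.map_apply_of_aemeasurable (hX _) hF.measurableSet]
  -- compare with the closed thickenings of `F`, whose probabilities decrease to that of `F`
  have hlim : Tendsto (fun r => ℙ (Y ⁻¹' Metric.cthickening r F)) (𝓝 0) (𝓝 (ℙ (Y ⁻¹' F))) := by
    have := Measure.isProbabilityMeasure_map hYm
    have := tendsto_measure_cthickening_of_isClosed (μ := ℙ.map Y) (s := F)
      ⟨1, one_pos, measure_ne_top _ _⟩ hF
    simpa only [Measure.map_apply_of_aemeasurable hYm hF.measurableSet,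
      Measure.map_apply_of_aemeasurable hYm Metric.isClosed_cthickening.measurableSet] using this
  refine ENNReal.le_of_forall_pos_le_add fun δ hδ _ => ?_
  have hδ' : (0 : ℝ≥0∞) < δ := by exact_mod_cast hδ
  have hδ2 : (0 : ℝ≥0∞) < δ / 4 := ENNReal.div_pos hδ'.ne' (by simp)
  have hfin : ∀ s : Set Ω, ℙ s ≠ ⊤ := fun s => measure_ne_top _ _
  have h1 : ∀ᶠ r in 𝓝[>] (0 : ℝ), ℙ (Y ⁻¹' Metric.cthickening r F) < ℙ (Y ⁻¹' F) + δ / 4 :=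
    (hlim.mono_left nhdsWithin_le_nhds).eventually_lt_const
      (ENNReal.lt_add_right (hfin _) hδ2.ne')
  obtain ⟨r, hr1, hr0⟩ := (h1.and self_mem_nhdsWithin).exists
  have hr0 : 0 < r := hr0
  have hc : IsClosed (Metric.cthickening r F) := Metric.isClosed_cthickening
  have h2 : ∀ᶠ n in atTop, ℙ (Y' n ⁻¹' Metric.cthickening r F) <
      ℙ (Y ⁻¹' Metric.cthickening r F) + δ / 4 :=
    eventually_lt_of_limsup_lt
      ((limsup_le_of_tendstoInDistribution_of_isClosed hYY hc).trans_lt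
        (ENNReal.lt_add_right (hfin _) hδ2.ne'))
  obtain ⟨n, hn2, hn3⟩ := (h2.and (happrox r hr0 (δ / 4) hδ2)).exists
  have h4 : ∀ᶠ i in l, P (X' n i ⁻¹' Metric.cthickening r F) <
      ℙ (Y' n ⁻¹' Metric.cthickening r F) + δ / 4 :=
    eventually_lt_of_limsup_lt
      ((limsup_le_of_tendstoInDistribution_of_isClosed (h n) hc).trans_lt
        (ENNReal.lt_add_right (hfin _) hδ2.ne'))
  refine limsup_le_of_le (by isBoundedDefault) ?_
  filter_upwards [hn3, h4] with i hi3 hi4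
  have hsub : X i ⁻¹' F ⊆ X' n i ⁻¹' Metric.cthickening r F ∪
      {ω | r ≤ dist (X i ω) (X' n i ω)} := by
    intro ω hω
    by_cases hd : r ≤ dist (X i ω) (X' n i ω)
    · exact Or.inr hd
    · refine Or.inl (Metric.mem_cthickening_of_dist_le _ (X i ω) _ _ hω ?_)
      rw [dist_comm]
      exact (not_le.1 hd).le
  have e : ℙ (Y ⁻¹' F) + δ / 4 + δ / 4 + δ / 4 + δ / 4 = ℙ (Y ⁻¹' F) + δ := by
    have h4 : (δ : ℝ≥0∞) / 4 = ((δ / 4 : ℝ≥0) : ℝ≥0∞) := by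
      rw [ENNReal.coe_div (by norm_num)]; norm_num
    have : δ / 4 + δ / 4 + δ / 4 + δ / 4 = δ := by ring
    rw [h4, add_assoc, add_assoc, add_assoc]
    congr 1
    rw [← ENNReal.coe_add, ← ENNReal.coe_add, ← ENNReal.coe_add, ← add_assoc, ← add_assoc, this]
  calc P (X i ⁻¹' F) ≤ P (X' n i ⁻¹' Metric.cthickening r F) +
        P {ω | r ≤ dist (X i ω) (X' n i ω)} :=
        (measure_mono hsub).trans (measure_union_le _ _)
    _ ≤ (ℙ (Y ⁻¹' F) + δ / 4 + δ / 4 + δ / 4) + δ / 4 := by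
        gcongr
        exact hi4.le.trans (by gcongr; exact hn2.le.trans (by gcongr))
    _ = _ := e

/-- Every entourage of the space of paths contains the pairs of paths that are close on a long
enough time interval. -/
theorem exists_entourage_of_path {E : Type*} [NormedAddCommGroup E]
    {V : Set (C(ℝ≥0, E) × C(ℝ≥0, E))} (hV : V ∈ uniformity C(ℝ≥0, E)) :
    ∃ T : ℝ≥0, ∃ η : ℝ, 0 < η ∧ ∀ u v : C(ℝ≥0, E), (∀ t ≤ T, dist (u t) (v t) < η) →
      (u, v) ∈ V := by
  obtain ⟨⟨K, η⟩, ⟨hK, hη⟩, h⟩ :=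
    (Metric.uniformity_basis_dist (α := E)).compactConvergenceUniformity.mem_iff.1 hV
  obtain ⟨T, hT⟩ := hK.bddAbove
  exact ⟨T, η, hη, fun u v huv => h fun t ht => huv t (hT ht)⟩

theorem tendsto_path_iff {ι E : Type*} [NormedAddCommGroup E] {l : Filter ι}
    {F : ι → C(ℝ≥0, E)} {u : C(ℝ≥0, E)} :
    Tendsto F l (𝓝 u) ↔
      ∀ T : ℝ≥0, ∀ η : ℝ, 0 < η → ∀ᶠ i in l, ∀ t ≤ T, dist (F i t) (u t) < η := by
  rw [ContinuousMap.tendsto_iff_forall_isCompact_tendstoUniformlyOn]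
  constructor
  · intro h T η hη
    filter_upwards [Metric.tendstoUniformlyOn_iff.1 (h (Icc 0 T) isCompact_Icc) η hη] with i hi t ht
    rw [dist_comm]
    exact hi t ⟨zero_le, ht⟩
  · intro h K hK
    obtain ⟨T, hT⟩ := hK.bddAbove
    refine Metric.tendstoUniformlyOn_iff.2 fun η hη => ?_
    filter_upwards [h T η hη] with i hi t ht
    rw [dist_comm]
    exact hi t (hT ht)

/-- A form of `tendstoInDistribution_of_approx` for random paths, with closeness measured on compact
time intervals. -/
theorem tendstoInDistribution_path_of_approx {ι M Ω E : Type*} [MeasurableSpace M]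
    [MeasurableSpace Ω] [NormedAddCommGroup E]
    {l : Filter ι} [l.IsCountablyGenerated] {P : Measure M} [IsProbabilityMeasure P]
    {ℙ : Measure Ω} [IsProbabilityMeasure ℙ] {X : ι → M → C(ℝ≥0, E)} {Y : Ω → C(ℝ≥0, E)}
    {X' : ℕ → ι → M → C(ℝ≥0, E)} {Y' : ℕ → Ω → C(ℝ≥0, E)} (hX : ∀ i, AEMeasurable (X i) P)
    (h : ∀ n, TendstoInDistribution (X' n) l (Y' n) (fun _ => P) ℙ)
    (hY : ∀ ω, Tendsto (fun n => Y' n ω) atTop (𝓝 (Y ω)))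
    (happrox : ∀ T : ℝ≥0, ∀ η : ℝ, 0 < η → ∀ δ : ℝ≥0∞, 0 < δ →
      ∀ᶠ n in atTop, ∀ᶠ i in l, P {ω | ∃ t ≤ T, η ≤ dist (X i ω t) (X' n i ω t)} ≤ δ) :
    TendstoInDistribution X l Y (fun _ => P) ℙ := by
  let _ : PseudoMetricSpace C(ℝ≥0, E) := UniformSpace.pseudoMetricSpace _
  refine tendstoInDistribution_of_approx hX h hY fun η hη δ hδ => ?_
  obtain ⟨T, η', hη', hT⟩ := exists_entourage_of_path (E := E) (Metric.dist_mem_uniformity hη)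
  filter_upwards [happrox T η' hη' δ hδ] with n hn
  filter_upwards [hn] with i hi
  refine (measure_mono fun ω hω => ?_).trans hi
  by_contra hcon
  simp only [mem_ofPred_eq, not_exists, not_and, not_le] at hcon hω
  exact absurd (hT _ _ hcon) (not_lt.2 hω)

/-- The extension of a path on `[0,T]` to `[0,∞)` that is constant after `T`. -/
noncomputable def extendPath {E : Type*} [TopologicalSpace E] (T : ℝ≥0)
    (u : C(Set.Icc (0 : ℝ≥0) T, E)) : C(ℝ≥0, E) :=
  u.comp ⟨Set.projIcc 0 T zero_le, continuous_projIcc⟩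

theorem continuous_extendPath {E : Type*} [TopologicalSpace E] (T : ℝ≥0) :
    Continuous (extendPath T : C(Set.Icc (0 : ℝ≥0) T, E) → C(ℝ≥0, E)) :=
  ContinuousMap.continuous_precomp _

theorem extendPath_restrictPath {E : Type*} [TopologicalSpace E] {T t : ℝ≥0} (ht : t ≤ T)
    (u : C(ℝ≥0, E)) : extendPath T (restrictPath T u) t = u t := by
  simp [extendPath, restrictPath, Set.projIcc_of_mem zero_le (show t ∈ Icc 0 T from ⟨zero_le, ht⟩)]

/-- Convergence in distribution on every compact time interval gives convergence in distribution
for locally uniform convergence. -/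
theorem tendstoInDistribution_path_of_restrict {ι M Ω E : Type*} [MeasurableSpace M]
    [MeasurableSpace Ω] [NormedAddCommGroup E]
    {l : Filter ι} [l.IsCountablyGenerated] {P : Measure M} [IsProbabilityMeasure P]
    {ℙ : Measure Ω} [IsProbabilityMeasure ℙ] {X : ι → M → C(ℝ≥0, E)} {Y : Ω → C(ℝ≥0, E)}
    (h : ∀ T : ℝ≥0, TendstoInDistribution (fun i ω => restrictPath T (X i ω)) l
      (fun ω => restrictPath T (Y ω)) (fun _ => P) ℙ) :
    TendstoInDistribution X l Y (fun _ => P) ℙ := by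
  have hconv : ∀ u : C(ℝ≥0, E),
      Tendsto (fun n : ℕ => extendPath (n : ℝ≥0) (restrictPath n u)) atTop (𝓝 u) := by
    intro u
    refine tendsto_path_iff.2 fun T η hη => ?_
    filter_upwards [eventually_ge_atTop ⌈T⌉₊] with n hn t ht
    rwa [extendPath_restrictPath (ht.trans (Nat.ceil_le.1 hn)), dist_self]
  have h' := fun n : ℕ => (h n).continuous_comp (continuous_extendPath (E := E) (n : ℝ≥0))
  refine tendstoInDistribution_path_of_approx
    (X' := fun (n : ℕ) i ω => extendPath (n : ℝ≥0) (restrictPath n (X i ω)))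
    (Y' := fun (n : ℕ) ω => extendPath (n : ℝ≥0) (restrictPath n (Y ω)))
    (fun i => ?_) h' (fun ω => hconv _) ?_
  · exact aemeasurable_of_tendsto_metrizable_ae atTop (fun n => (h' n).forall_aemeasurable i)
      (ae_of_all _ fun ω => hconv _)
  · intro T η hη δ hδ
    filter_upwards [eventually_ge_atTop ⌈T⌉₊] with n hn
    refine Eventually.of_forall fun i => ?_
    have : {ω | ∃ t ≤ T, η ≤
        dist (X i ω t) (extendPath (n : ℝ≥0) (restrictPath n (X i ω)) t)} = ∅ := by
      refine eq_empty_of_forall_notMem fun ω => ?_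
      rintro ⟨t, ht, hd⟩
      rw [extendPath_restrictPath (ht.trans (Nat.ceil_le.1 hn)), dist_self] at hd
      exact absurd hη (not_lt.2 hd)
    rw [this]
    simp

/-- A random path is measurable as soon as all its values are. -/
theorem measurable_path_of_eval {M S E : Type*} [MeasurableSpace M] [TopologicalSpace S]
    [SecondCountableTopology S] [LocallyCompactSpace S]
    [NormedAddCommGroup E] [SecondCountableTopology E] [MeasurableSpace E] [BorelSpace E]
    {X : M → C(S, E)} (h : ∀ t, Measurable fun ω => X ω t) : Measurable X := by
  have hgen : (continuousMapMeasurableSpace : MeasurableSpace C(S, E)) = _ :=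
    borel_eq_generateFrom_of_subbasis (ContinuousMap.compactOpen_eq (X := S) (Y := E))
  rw [hgen]
  refine measurable_generateFrom ?_
  rintro _ ⟨K, hK, U, hU, rfl⟩
  obtain ⟨D, hDc, hD⟩ := TopologicalSpace.exists_countable_dense K
  let F : ℕ → Set E := fun n => (Metric.thickening (1 / ((n : ℝ) + 1)) Uᶜ)ᶜ
  have hF : ∀ n, IsClosed (F n) := fun n => Metric.isOpen_thickening.isClosed_compl
  have hFU : ∀ n, F n ⊆ U := fun n => by
    rw [← compl_subset_compl, compl_compl]
    exact Metric.self_subset_thickening Nat.one_div_pos_of_nat _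
  -- a path maps the compact set `K` into `U` if and only if it stays away from `Uᶜ` by a positive
  -- distance on a countable dense subset of `K`
  have key : X ⁻¹' {u | MapsTo u K U} = ⋃ n, ⋂ t ∈ D, {ω | X ω (t : S) ∈ F n} := by
    ext ω
    simp only [mem_preimage, mem_ofPred_eq, mem_iUnion, mem_iInter]
    constructor
    · intro hω
      have hdisj : Disjoint (X ω '' K) Uᶜ :=
        disjoint_compl_right_iff_subset.2 hω.image_subset
      obtain ⟨δ, hδ, hd⟩ := hdisj.exists_thickenings (hK.image (X ω).continuous) hU.isClosed_compl
      obtain ⟨n, hn⟩ := exists_nat_one_div_lt hδ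
      refine ⟨n, fun t _ ht => ?_⟩
      exact disjoint_left.1 hd (Metric.self_subset_thickening hδ _ (mem_image_of_mem _ t.2))
        (Metric.thickening_mono hn.le _ ht)
    · rintro ⟨n, hn⟩ t ht
      have hcl : IsClosed {t : K | X ω (t : S) ∈ F n} :=
        (hF n).preimage ((X ω).continuous.comp continuous_subtype_val)
      have : (univ : Set K) ⊆ {t : K | X ω (t : S) ∈ F n} := by
        rw [← hD.closure_eq]
        exact closure_minimal (fun t ht => hn t ht) hcl
      exact hFU n (this (mem_univ (⟨t, ht⟩ : K)))
  rw [key]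
  exact MeasurableSet.iUnion fun n => MeasurableSet.biInter hDc fun t _ =>
    h t (hF n).measurableSet

/-- Convergence in distribution to zero on `[0,T]` is convergence to zero in probability. -/
theorem tendsto_measure_of_tendstoInDistribution_zero {ι M Ω E : Type*} [MeasurableSpace M]
    [MeasurableSpace Ω] [NormedAddCommGroup E] {l : Filter ι} {P : Measure M}
    [IsProbabilityMeasure P] {ℙ : Measure Ω} [IsProbabilityMeasure ℙ] {X : ι → M → C(ℝ≥0, E)}
    {T : ℝ≥0} (h : TendstoInDistribution (fun i ω => restrictPath T (X i ω)) l
      (fun _ => (0 : C(Icc (0 : ℝ≥0) T, E))) (fun _ => P) ℙ) {η : ℝ} (hη : 0 < η) :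
    Tendsto (fun i => P {ω | ∃ t ≤ T, η ≤ ‖X i ω t‖}) l (𝓝 0) := by
  have hF : IsClosed {u : C(Icc (0 : ℝ≥0) T, E) | η ≤ ‖u‖} :=
    isClosed_le continuous_const continuous_norm
  have h0 := limsup_le_of_tendstoInDistribution_of_isClosed h hF
  have hemp : (fun _ : Ω => (0 : C(Icc (0 : ℝ≥0) T, E))) ⁻¹' {u | η ≤ ‖u‖} = ∅ := by
    ext; simp [hη]
  rw [hemp, measure_empty] at h0
  refine tendsto_of_le_liminf_of_limsup_le zero_le (h0.trans' (limsup_le_limsup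
    (Eventually.of_forall fun i => measure_mono ?_)))
  rintro ω ⟨t, ht, hω⟩
  exact hω.trans ((restrictPath T (X i ω)).norm_coe_le_norm ⟨t, zero_le, ht⟩)

/-- A family of real random variables that converges in distribution is tight. -/
theorem exists_measure_le_of_tendstoInDistribution {ι M Ω : Type*} [MeasurableSpace M]
    [MeasurableSpace Ω] {l : Filter ι} {P : Measure M} [IsProbabilityMeasure P]
    {ℙ : Measure Ω} [IsProbabilityMeasure ℙ] {X : ι → M → ℝ} {Y : Ω → ℝ}
    (h : TendstoInDistribution X l Y (fun _ => P) ℙ) {δ : ℝ≥0∞} (hδ : 0 < δ) :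
    ∃ K : ℝ, 0 < K ∧ ∀ᶠ i in l, P {ω | K ≤ X i ω} ≤ δ := by
  have hanti : Antitone fun n : ℕ => Y ⁻¹' Ici (n : ℝ) := fun m n hmn =>
    preimage_mono (Ici_subset_Ici.2 (by exact_mod_cast hmn))
  have hlim := tendsto_measure_iInter_atTop (μ := ℙ)
    (fun n => h.aemeasurable_limit.nullMeasurableSet_preimage
      (measurableSet_Ici (a := ((n : ℕ) : ℝ)))) hanti ⟨0, measure_ne_top _ _⟩
  have hemp : ⋂ n : ℕ, Y ⁻¹' Ici (n : ℝ) = ∅ := by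
    refine eq_empty_of_forall_notMem fun ω hω => ?_
    obtain ⟨n, hn⟩ := exists_nat_gt (Y ω)
    exact absurd (mem_iInter.1 hω n) (not_le.2 hn)
  rw [hemp, measure_empty] at hlim
  obtain ⟨n, hn, hn1⟩ := ((hlim.eventually_lt_const hδ).and (eventually_ge_atTop 1)).exists
  refine ⟨n, by exact_mod_cast hn1, ?_⟩
  filter_upwards [eventually_lt_of_limsup_lt
    ((limsup_le_of_tendstoInDistribution_of_isClosed h isClosed_Ici).trans_lt hn)] with i hi
  exact hi.le

/-! ### Linear Volterra equations -/

/-- **Grönwall's inequality** in integral form. -/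
theorem le_mul_exp_of_le_add_mul_integral {u : ℝ → ℝ} (hu : ContinuousOn u (Ici 0)) {a K T : ℝ}
    (hK : 0 ≤ K)
    (h : ∀ t, 0 ≤ t → t ≤ T → u t ≤ a + K * ∫ s in (0 : ℝ)..t, u s) {t : ℝ} (ht : 0 ≤ t)
    (htT : t ≤ T) : u t ≤ a * Real.exp (K * t) := by
  let w : ℝ → ℝ := fun s => u (max s 0)
  have hw : Continuous w :=
    hu.comp_continuous (continuous_id.max continuous_const) fun s => le_max_right s 0
  have hwu : ∀ t, 0 ≤ t → ∫ s in (0 : ℝ)..t, u s = ∫ s in (0 : ℝ)..t, w s := fun t ht =>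
    intervalIntegral.integral_congr fun s hs => by
      rw [uIcc_of_le ht] at hs
      simp [w, hs.1]
  have hd : ∀ r, HasDerivAt (fun t => a + K * ∫ s in (0 : ℝ)..t, w s) (K * w r) r := fun r =>
    ((intervalIntegral.integral_hasDerivAt_right (hw.intervalIntegrable _ _)
      (hw.stronglyMeasurableAtFilter _ _) hw.continuousAt).const_mul K).const_add a
  have := le_gronwallBound_of_liminf_deriv_right_le (f := fun t => a + K * ∫ s in (0 : ℝ)..t, w s)
    (f' := fun r => K * w r) (δ := a) (K := K) (ε := 0) (a := 0) (b := T)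
    (fun r _ => (hd r).continuousAt.continuousWithinAt)
    (fun r _ _ hr' => (hd r).hasDerivWithinAt.liminf_right_slope_le hr')
    (by simp) (fun r hr => by
      rw [add_zero]
      refine mul_le_mul_of_nonneg_left ?_ hK
      rw [← hwu r hr.1]
      simpa [w, hr.1] using h r hr.1 hr.2.le) t ⟨ht, htT⟩
  rw [gronwallBound_ε0, sub_zero] at this
  exact (h t ht htT).trans (by rwa [hwu t ht])

section Volterra

variable {E : Type*} [NormedAddCommGroup E] [NormedSpace ℝ E]

/-- Continuity of the integrand of a linear Volterra equation along a path. -/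
theorem continuous_clm_apply_path {A : ℝ → E →L[ℝ] E} (hA : Continuous A) (v : C(ℝ≥0, E)) :
    Continuous fun s : ℝ => A s (v s.toNNReal) :=
  hA.clm_apply (v.continuous.comp continuous_real_toNNReal)

/-- The Volterra operator `v ↦ ∫_0^t A_s v_s ds` on paths. -/
noncomputable def volterraMap (A : ℝ → E →L[ℝ] E) (hA : Continuous A) (v : C(ℝ≥0, E)) :
    C(ℝ≥0, E) where
  toFun t := ∫ s in (0 : ℝ)..t, A s (v s.toNNReal)
  continuous_toFun := (intervalIntegral.continuous_primitive
    (fun a b => (continuous_clm_apply_path hA v).intervalIntegrable a b) 0).comp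
    NNReal.continuous_coe

variable {A : ℝ → E →L[ℝ] E} {C : ℝ}

/-- The factorial decay that makes the series of iterates of the Volterra operator converge. -/
theorem norm_volterraMap_iterate_le (hA : Continuous A) (hC : ∀ s, ‖A s‖ ≤ C) (v : C(ℝ≥0, E))
    {T : ℝ≥0} {m : ℝ} (hm : ∀ t ≤ T, ‖v t‖ ≤ m) (n : ℕ) :
    ∀ t ≤ T, ‖(volterraMap A hA)^[n] v t‖ ≤ m * ((C * t) ^ n / n.factorial) := by
  have hC0 : 0 ≤ C := (norm_nonneg _).trans (hC 0)
  induction n with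
  | zero => simpa using hm
  | succ n ih =>
    intro t ht
    rw [Function.iterate_succ_apply']
    have hb : ∀ s ∈ Ioc (0 : ℝ) t, ‖A s (((volterraMap A hA)^[n] v) s.toNNReal)‖ ≤
        C * (m * ((C * s) ^ n / n.factorial)) := by
      intro s hs
      have hsT : s.toNNReal ≤ T := (Real.toNNReal_le_iff_le_coe.2 hs.2).trans ht
      have := ih _ hsT
      rw [Real.coe_toNNReal _ hs.1.le] at this
      exact ((A s).le_opNorm _).trans (mul_le_mul (hC s) this (norm_nonneg _) hC0)
    refine (intervalIntegral.norm_integral_le_of_norm_le t.2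
      (ae_of_all _ hb) (Continuous.intervalIntegrable (by fun_prop) _ _)).trans (le_of_eq ?_)
    have : (fun s : ℝ => C * (m * ((C * s) ^ n / n.factorial))) =
        fun s : ℝ => (C * m * C ^ n / n.factorial) * s ^ n := by
      ext s; rw [mul_pow]; ring
    simp only [this, intervalIntegral.integral_const_mul, integral_pow, Nat.factorial_succ]
    have : ((n : ℝ) + 1) ≠ 0 := by positivity
    have h2 : (n.factorial : ℝ) ≠ 0 := by positivity
    push_cast
    simp only [NNReal.val_eq_coe]
    field_simp
    ring

theorem volterraMap_sub (hA : Continuous A) (u v : C(ℝ≥0, E)) :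
    volterraMap A hA (u - v) = volterraMap A hA u - volterraMap A hA v := by
  ext t
  simp only [volterraMap, ContinuousMap.coe_mk, ContinuousMap.sub_apply, map_sub]
  exact intervalIntegral.integral_sub
    ((continuous_clm_apply_path hA u).intervalIntegrable _ _)
    ((continuous_clm_apply_path hA v).intervalIntegrable _ _)

theorem continuous_volterraMap (hA : Continuous A) (hC : ∀ s, ‖A s‖ ≤ C) :
    Continuous (volterraMap A hA) := by
  have hC0 : 0 ≤ C := (norm_nonneg _).trans (hC 0)
  refine continuous_iff_continuousAt.2 fun v => tendsto_path_iff.2 fun T η hη => ?_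
  have hpos : 0 < C * T + 1 := by positivity
  filter_upwards [tendsto_path_iff.1 (tendsto_id (x := 𝓝 v)) T (η / (C * T + 1)) (by positivity)]
    with u hu t ht
  rw [dist_eq_norm, ← ContinuousMap.sub_apply, ← volterraMap_sub hA]
  have := norm_volterraMap_iterate_le hA hC (u - v) (T := T) (m := η / (C * T + 1))
    (fun t ht => by simpa [dist_eq_norm] using (hu t ht).le) 1 t ht
  simp only [Function.iterate_one, pow_one, Nat.factorial_one, Nat.cast_one, div_one] at this
  refine this.trans_lt ?_
  rw [div_mul_eq_mul_div, div_lt_iff₀ hpos]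
  have : C * (t : ℝ) ≤ C * T := mul_le_mul_of_nonneg_left (by exact_mod_cast ht) hC0
  nlinarith

/-- The solution of a linear Volterra equation depends continuously on the driving term, by
Grönwall's inequality. -/
theorem volterra_stability (hA : Continuous A) (hC : ∀ s, ‖A s‖ ≤ C) {u v y z : C(ℝ≥0, E)}
    (hy : y = u + volterraMap A hA y) (hz : z = v + volterraMap A hA z) {T : ℝ≥0} {η : ℝ}
    (h : ∀ t ≤ T, ‖u t - v t‖ ≤ η) : ∀ t ≤ T, ‖y t - z t‖ ≤ η * Real.exp (C * t) := by
  have hC0 : 0 ≤ C := (norm_nonneg _).trans (hC 0)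
  intro t ht
  have hcont : Continuous fun s : ℝ => ‖y s.toNNReal - z s.toNNReal‖ :=
    ((y.continuous.sub z.continuous).comp continuous_real_toNNReal).norm
  have := le_mul_exp_of_le_add_mul_integral (u := fun s => ‖y s.toNNReal - z s.toNNReal‖)
    (a := η) (K := C) (T := T) hcont.continuousOn hC0 (fun r hr hrT => ?_) t.2 ht
  · simpa using this
  have hrT' : r.toNNReal ≤ T := Real.toNNReal_le_iff_le_coe.2 hrT
  have e : y r.toNNReal - z r.toNNReal = (u r.toNNReal - v r.toNNReal) +
      volterraMap A hA (y - z) r.toNNReal := by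
    conv_lhs => rw [hy, hz]
    rw [volterraMap_sub]
    simp only [ContinuousMap.add_apply, ContinuousMap.sub_apply]
    abel
  rw [e]
  refine (norm_add_le _ _).trans (add_le_add (h _ hrT') ?_)
  simp only [volterraMap, ContinuousMap.coe_mk, Real.coe_toNNReal _ hr]
  rw [← intervalIntegral.integral_const_mul]
  refine intervalIntegral.norm_integral_le_of_norm_le hr (ae_of_all _ fun s _ => ?_)
    ((hcont.const_smul C).intervalIntegrable _ _)
  exact ((A s).le_opNorm _).trans (mul_le_mul_of_nonneg_right (hC s) (norm_nonneg _))

theorem volterra_unique (hA : Continuous A) (hC : ∀ s, ‖A s‖ ≤ C) {v y z : C(ℝ≥0, E)}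
    (hy : y = v + volterraMap A hA y) (hz : z = v + volterraMap A hA z) : y = z := by
  ext t
  have := volterra_stability hA hC hy hz (T := t) (η := 0) (by simp) t le_rfl
  rw [zero_mul] at this
  exact sub_eq_zero.1 (norm_le_zero_iff.1 this)

variable [CompleteSpace E]

/-- The linear Volterra equation `y_t = v_t + ∫_0^t A_s y_s ds` has a solution, the sum of the
iterates of the Volterra operator. -/
theorem exists_volterra_solution (hA : Continuous A) (hC : ∀ s, ‖A s‖ ≤ C) (v : C(ℝ≥0, E)) :
    ∃ y : C(ℝ≥0, E), y = v + volterraMap A hA y := by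
  have hC0 : 0 ≤ C := (norm_nonneg _).trans (hC 0)
  let L : C(ℝ≥0, E) →+ C(ℝ≥0, E) := AddMonoidHom.ofMapSub (volterraMap A hA) (volterraMap_sub hA)
  have hs : Summable fun n => (volterraMap A hA)^[n] v := by
    refine ContinuousMap.summable_of_locally_summable_norm fun K => ?_
    obtain ⟨T, hT⟩ := K.isCompact.bddAbove
    obtain ⟨m, hm⟩ := (isCompact_Icc (a := (0 : ℝ≥0)) (b := T)).exists_bound_of_continuousOn
      v.continuous.continuousOn
    have hm0 : 0 ≤ m := (norm_nonneg _).trans (hm 0 ⟨le_rfl, zero_le⟩)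
    refine Summable.of_nonneg_of_le (fun _ => norm_nonneg _) (fun n => ?_)
      ((Real.summable_pow_div_factorial (C * T)).mul_left m)
    refine (ContinuousMap.norm_le _ (by positivity)).2 fun t => ?_
    have ht : (t : ℝ≥0) ≤ T := hT t.2
    refine (norm_volterraMap_iterate_le hA hC v (fun s hs => hm s ⟨zero_le, hs⟩) n t ht).trans ?_
    gcongr
  refine ⟨∑' n, (volterraMap A hA)^[n] v, ?_⟩
  have h1 : volterraMap A hA (∑' n, (volterraMap A hA)^[n] v) =
      ∑' n, (volterraMap A hA)^[n + 1] v := by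
    have := (hs.hasSum.map L (continuous_volterraMap hA hC)).tsum_eq
    simp only [Function.comp_def] at this
    rw [show volterraMap A hA (∑' n, (volterraMap A hA)^[n] v) =
      L (∑' n, (volterraMap A hA)^[n] v) from rfl, ← this]
    exact tsum_congr fun n => (Function.iterate_succ_apply' _ _ _).symm
  rw [h1]
  exact hs.tsum_eq_zero_add

/-- The solution map `v ↦ y` of the linear Volterra equation `y_t = v_t + ∫_0^t A_s y_s ds`. -/
noncomputable def volterraSolution (hA : Continuous A) (hC : ∀ s, ‖A s‖ ≤ C) (v : C(ℝ≥0, E)) :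
    C(ℝ≥0, E) :=
  (exists_volterra_solution hA hC v).choose

theorem volterraSolution_eq (hA : Continuous A) (hC : ∀ s, ‖A s‖ ≤ C) (v : C(ℝ≥0, E)) :
    volterraSolution hA hC v = v + volterraMap A hA (volterraSolution hA hC v) :=
  (exists_volterra_solution hA hC v).choose_spec

theorem continuous_volterraSolution (hA : Continuous A) (hC : ∀ s, ‖A s‖ ≤ C) :
    Continuous (volterraSolution hA hC) := by
  have hC0 : 0 ≤ C := (norm_nonneg _).trans (hC 0)
  refine continuous_iff_continuousAt.2 fun v => tendsto_path_iff.2 fun T η hη => ?_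
  have hη' : 0 < η / 2 * Real.exp (-(C * T)) := by positivity
  filter_upwards [tendsto_path_iff.1 (tendsto_id (x := 𝓝 v)) T _ hη'] with u hu t ht
  rw [dist_eq_norm]
  refine (volterra_stability hA hC (volterraSolution_eq hA hC u) (volterraSolution_eq hA hC v)
    (T := T) (fun s hs => by simpa [dist_eq_norm] using (hu s hs).le) t ht).trans_lt ?_
  rw [mul_assoc, ← Real.exp_add]
  have : Real.exp (-(C * T) + C * t) ≤ 1 := by
    rw [Real.exp_le_one_iff]
    have : C * (t : ℝ) ≤ C * T := mul_le_mul_of_nonneg_left (by exact_mod_cast ht) hC0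
    linarith
  nlinarith

/-- If the operators `A_s` commute, `exp (∫_0^t A_u du)` is the resolvent of `y' = A_t y`, which
gives the solution of the Volterra equation by variation of constants. -/
theorem volterraSolution_eq_of_commute (hA : Continuous A) (hC : ∀ s, ‖A s‖ ≤ C)
    (hcomm : ∀ s t, Commute (A s) (A t)) (v : C(ℝ≥0, E)) (t : ℝ≥0) :
    volterraSolution hA hC v t = v t + ∫ s in (0 : ℝ)..t,
      (A s * NormedSpace.exp (∫ u in s..t, A u)) (v s.toNNReal) := by
  let _ : NormedAlgebra ℚ (E →L[ℝ] E) := NormedAlgebra.restrictScalars ℚ ℝ _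
  let B : ℝ → E →L[ℝ] E := fun t => ∫ u in (0 : ℝ)..t, A u
  have hint : ∀ a b, IntervalIntegrable A volume a b := fun a b => hA.intervalIntegrable a b
  have hB : ∀ t, HasDerivAt B (A t) t := fun t =>
    intervalIntegral.integral_hasDerivAt_right (hint _ _) (hA.stronglyMeasurableAtFilter _ _)
      hA.continuousAt
  have hBc : Continuous B := continuous_iff_continuousAt.2 fun t => (hB t).continuousAt
  have hAB : ∀ s t, Commute (A s) (B t) := fun s t => by
    have h1 := ((ContinuousLinearMap.mul ℝ (E →L[ℝ] E)) (A s)).intervalIntegral_comp_comm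
      (hint 0 t)
    have h2 := ((ContinuousLinearMap.mul ℝ (E →L[ℝ] E)).flip (A s)).intervalIntegral_comp_comm
      (hint 0 t)
    simp only [ContinuousLinearMap.mul_apply', ContinuousLinearMap.flip_apply] at h1 h2
    rw [commute_iff_eq, ← h1, ← h2]
    exact intervalIntegral.integral_congr fun u _ => hcomm s u
  have hBB : ∀ s t, Commute (B s) (B t) := fun s t => by
    have h1 := ((ContinuousLinearMap.mul ℝ (E →L[ℝ] E)) (B s)).intervalIntegral_comp_comm
      (hint 0 t)
    have h2 := ((ContinuousLinearMap.mul ℝ (E →L[ℝ] E)).flip (B s)).intervalIntegral_comp_comm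
      (hint 0 t)
    simp only [ContinuousLinearMap.mul_apply', ContinuousLinearMap.flip_apply] at h1 h2
    rw [commute_iff_eq, ← h1, ← h2]
    exact intervalIntegral.integral_congr fun u _ => (hAB u s).symm
  -- the resolvent and its inverse
  let e : ℝ → E →L[ℝ] E := fun t => NormedSpace.exp (B t)
  let e' : ℝ → E →L[ℝ] E := fun t => NormedSpace.exp (-B t)
  have hee : ∀ t, e t * e' t = 1 := fun t => by
    have := NormedSpace.exp_add_of_commute (Commute.neg_right (Commute.refl (B t)))
    rw [add_neg_cancel, NormedSpace.exp_zero] at this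
    exact this.symm
  have he : ∀ t, HasDerivAt e (e t * A t) t := fun t => by
    -- `exp (B r) = exp (B t) exp (B r - B t)`, and the derivative of `exp` at `0` is the identity
    have h1 : HasDerivAt (fun r => B r - B t) (A t) t := (hB t).sub_const _
    have h2 : HasFDerivAt (𝕜 := ℝ) (NormedSpace.exp : (E →L[ℝ] E) → (E →L[ℝ] E)) 1 (B t - B t) := by
      rw [sub_self]; exact hasFDerivAt_exp_zero (𝕂 := ℝ)
    have h3 := (h2.comp_hasDerivAt t h1).const_mul (e t)
    refine h3.congr_of_eventuallyEq (Eventually.of_forall fun r => ?_)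
    have := NormedSpace.exp_add_of_commute
      (Commute.sub_right (hBB t r) (Commute.refl (B t)))
    rw [add_sub_cancel] at this
    exact this
  have hec' : Continuous e' := (NormedSpace.exp_continuous (𝔸 := E →L[ℝ] E)).comp hBc.neg
  have hgc : Continuous fun s : ℝ => (A s * e' s) (v s.toNNReal) :=
    (hA.mul hec').clm_apply (v.continuous.comp continuous_real_toNNReal)
  let J : ℝ → E := fun t => ∫ s in (0 : ℝ)..t, (A s * e' s) (v s.toNNReal)
  have hJ : ∀ t, HasDerivAt J ((A t * e' t) (v t.toNNReal)) t := fun t =>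
    intervalIntegral.integral_hasDerivAt_right (hgc.intervalIntegrable _ _)
      (hgc.stronglyMeasurableAtFilter _ _) hgc.continuousAt
  have hform : ∀ t : ℝ, ∫ s in (0 : ℝ)..t,
      (A s * NormedSpace.exp (∫ u in s..t, A u)) (v s.toNNReal) = e t (J t) := fun t => by
    rw [← (e t).intervalIntegral_comp_comm (hgc.intervalIntegrable _ _)]
    refine intervalIntegral.integral_congr fun s _ => ?_
    have h1 : ∫ u in s..t, A u = B t + -B s := by
      rw [← intervalIntegral.integral_interval_sub_left (hint 0 t) (hint 0 s), sub_eq_add_neg]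
    have h2 : A s * e t = e t * A s := (hAB s t).exp_right
    have h3 := NormedSpace.exp_add_of_commute (hBB t s).neg_right
    change (A s * NormedSpace.exp (∫ u in s..t, A u)) (v s.toNNReal) =
      (e t * (A s * e' s)) (v s.toNNReal)
    rw [h1, h3, ← mul_assoc, ← mul_assoc]
    exact congrArg (fun L : E →L[ℝ] E => (L * e' s) (v s.toNNReal)) h2
  have hy : ∀ t, HasDerivAt (fun t => e t (J t)) (A t (v t.toNNReal + e t (J t))) t := fun t => by
    refine ((he t).clm_apply (hJ t)).congr_deriv ?_
    have h2 : e t * A t = A t * e t := (hAB t t).exp_right.symm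
    have h4 : e t * (A t * e' t) = A t := by
      rw [← mul_assoc, h2, mul_assoc, hee, mul_one]
    have h5 := congrArg (fun L : E →L[ℝ] E => L (v t.toNNReal)) h4
    have h6 := congrArg (fun L : E →L[ℝ] E => L (J t)) h2
    simp only [mul_apply_eq_comp] at h5 h6
    rw [map_add, add_comm]
    exact congrArg₂ (· + ·) h5 h6
  have hyc : Continuous fun t => e t (J t) :=
    continuous_iff_continuousAt.2 fun t => (hy t).continuousAt
  let z : C(ℝ≥0, E) := v + ⟨fun t => e t (J t), hyc.comp NNReal.continuous_coe⟩
  have hz : z = v + volterraMap A hA z := by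
    ext t
    simp only [z, ContinuousMap.add_apply, ContinuousMap.coe_mk, volterraMap]
    congr 1
    have := intervalIntegral.integral_eq_sub_of_hasDerivAt (a := 0) (b := t) (fun r _ => hy r)
      ((hA.clm_apply ((v.continuous.comp continuous_real_toNNReal).add hyc)).intervalIntegrable _ _)
    have hJ0 : J 0 = 0 := intervalIntegral.integral_same
    rw [hJ0, map_zero, sub_zero] at this
    rw [← this]
    refine intervalIntegral.integral_congr fun s hs => ?_
    rw [uIcc_of_le t.coe_nonneg] at hs
    simp only [Real.coe_toNNReal _ hs.1]
  rw [volterra_unique hA hC (volterraSolution_eq hA hC v) hz, hform]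
  rfl

end Volterra

/-! ### Measurability of solutions of random differential equations -/

theorem IsSolution.congr {E : Type*} [NormedAddCommGroup E] [NormedSpace ℝ E] {F F' : ℝ → E → E}
    {x : E} {y : ℝ → E} (h : IsSolution F x y) (hF : ∀ s, 0 ≤ s → F s = F' s) :
    IsSolution F' x y :=
  ⟨h.1, fun t ht => by
    rw [h.2 t ht]
    congr 1
    refine intervalIntegral.integral_congr fun s hs => ?_
    rw [uIcc_of_le ht] at hs
    simp only [hF s hs.1]⟩

theorem IsSolution.aestronglyMeasurable {E : Type*} [NormedAddCommGroup E] [NormedSpace ℝ E]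
    {F : ℝ → E → E} {x : E} {y : ℝ → E} (h : IsSolution F x y) (t : ℝ) :
    AEStronglyMeasurable y (volume.restrict (Ioc 0 t)) :=
  (h.1.mono fun _ hs => hs.1.le).aestronglyMeasurable measurableSet_Ioc

section Solutions

variable {E : Type*} [NormedAddCommGroup E] [NormedSpace ℝ E] [SecondCountableTopology E]
  [MeasurableSpace E] [BorelSpace E]

theorem IsSolution.intervalIntegrable {F : ℝ → E → E} {x : E} {y : ℝ → E}
    (h : IsSolution F x y) {H : ℝ → E → E} (hH : Measurable (Function.uncurry H)) {C : ℝ}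
    (hC : ∀ s y, ‖H s y‖ ≤ C) {t : ℝ} (ht : 0 ≤ t) :
    IntervalIntegrable (fun s => H s (y s)) volume 0 t := by
  rw [intervalIntegrable_iff_integrableOn_Ioc_of_le ht]
  refine IntegrableOn.of_bound (by simp) ?_ C (ae_of_all _ fun s => hC _ _)
  exact (hH.comp_aemeasurable (aemeasurable_id.prodMk
    (h.aestronglyMeasurable t).aemeasurable)).aestronglyMeasurable

theorem IsSolution.norm_sub_le {F : ℝ → E → E} {x : E} {y : ℝ → E}
    (h : IsSolution F x y) (hF : Measurable (Function.uncurry F)) {C : ℝ}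
    (hC : ∀ s y, ‖F s y‖ ≤ C) {r t : ℝ} (hr : 0 ≤ r) (hrt : r ≤ t) :
    ‖y t - y r‖ ≤ C * (t - r) := by
  have hi := fun t ht => h.intervalIntegrable hF hC (t := t) ht
  rw [h.2 t (hr.trans hrt), h.2 r hr, add_sub_add_left_eq_sub,
    intervalIntegral.integral_interval_sub_left (hi _ (hr.trans hrt)) (hi _ hr)]
  refine (intervalIntegral.norm_integral_le_of_norm_le_const fun s _ => hC s _).trans ?_
  rw [abs_of_nonneg (sub_nonneg.2 hrt)]

/-- The Picard iterates of a differential equation with a random right-hand side. The indicator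
function makes the dependence on the upper limit of integration measurable. -/
noncomputable def picardIterate {M : Type*} (F : ℝ → M → E → E) (x : E) : ℕ → ℝ → M → E
  | 0 => fun _ _ => x
  | n + 1 => fun t ω =>
    x + ∫ s, (Ioc 0 t).indicator (fun s => F s ω (picardIterate F x n s ω)) s

theorem measurable_picardIterate {M : Type*} [MeasurableSpace M] {F : ℝ → M → E → E}
    (hF : Measurable fun p : (ℝ × M) × E => F p.1.1 p.1.2 p.2) (x : E) (n : ℕ) :
    Measurable fun p : ℝ × M => picardIterate F x n p.1 p.2 := by
  induction n with
  | zero => exact measurable_const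
  | succ n ih =>
    have h1 : Measurable fun q : (ℝ × M) × ℝ => F q.2 q.1.2 (picardIterate F x n q.2 q.1.2) := by
      have : Measurable fun q : (ℝ × M) × ℝ => (q.2, q.1.2) := by fun_prop
      exact hF.comp (this.prodMk (ih.comp this))
    have hS : MeasurableSet {q : (ℝ × M) × ℝ | q.2 ∈ Ioc 0 q.1.1} :=
      (measurableSet_lt measurable_const measurable_snd).inter
        (measurableSet_le measurable_snd (measurable_fst.comp measurable_fst))
    have h2 := (h1.indicator hS).stronglyMeasurable.integral_prod_right' (ν := volume)
    exact measurable_const.add h2.measurable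

theorem norm_picardIterate_sub_le {M : Type*} [MeasurableSpace M] {F : ℝ → M → E → E}
    (hF : Measurable fun p : (ℝ × M) × E => F p.1.1 p.1.2 p.2) {C K : ℝ}
    (hC : ∀ s ω y, ‖F s ω y‖ ≤ C) (hK : 0 ≤ K)
    (hlip : ∀ s ω y z, ‖F s ω y - F s ω z‖ ≤ K * ‖y - z‖) {x : E} {ω : M} {y : ℝ → E}
    (hy : IsSolution (fun s => F s ω) x y) {T : ℝ} (n : ℕ) :
    ∀ t, 0 ≤ t → t ≤ T →
      ‖picardIterate F x n t ω - y t‖ ≤ C * T * ((K * t) ^ n / n.factorial) := by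
  have hFω : Measurable (Function.uncurry fun s => F s ω) :=
    hF.comp (by fun_prop : Measurable fun p : ℝ × E => ((p.1, ω), p.2))
  have hC0 : 0 ≤ C := (norm_nonneg _).trans (hC 0 ω 0)
  induction n with
  | zero =>
    intro t ht htT
    have := hy.norm_sub_le hFω (fun s y => hC s ω y) le_rfl ht
    rw [hy.2 0 le_rfl, intervalIntegral.integral_same, add_zero, sub_zero] at this
    rw [norm_sub_rev]
    simp only [picardIterate, pow_zero, Nat.factorial_zero, Nat.cast_one, div_one, mul_one]
    exact this.trans (mul_le_mul_of_nonneg_left htT hC0)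
  | succ n ih =>
    intro t ht htT
    have e : picardIterate F x (n + 1) t ω =
        x + ∫ s in (0 : ℝ)..t, F s ω (picardIterate F x n s ω) := by
      rw [intervalIntegral.integral_of_le ht, ← integral_indicator measurableSet_Ioc]
      rfl
    have hi : IntervalIntegrable (fun s => F s ω (picardIterate F x n s ω)) volume 0 t := by
      rw [intervalIntegrable_iff_integrableOn_Ioc_of_le ht]
      refine IntegrableOn.of_bound (by simp) ?_ C (ae_of_all _ fun s => hC _ _ _)
      have h1 : Measurable fun s => picardIterate F x n s ω :=
        (measurable_picardIterate hF x n).comp (by fun_prop : Measurable fun s : ℝ => (s, ω))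
      exact (hFω.comp (measurable_id.prodMk h1)).aestronglyMeasurable
    rw [e, hy.2 t ht, add_sub_add_left_eq_sub, ← intervalIntegral.integral_sub hi
      (hy.intervalIntegrable hFω (fun s y => hC s ω y) ht)]
    refine (intervalIntegral.norm_integral_le_of_norm_le
      (g := fun s => C * T * K ^ (n + 1) / n.factorial * s ^ n) ht
      (ae_of_all _ fun s hs => ?_) (Continuous.intervalIntegrable (by fun_prop) _ _)).trans
        (le_of_eq ?_)
    · refine (hlip _ _ _ _).trans ((mul_le_mul_of_nonneg_left
        (ih s hs.1.le (hs.2.trans htT)) hK).trans (le_of_eq ?_))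
      rw [mul_pow]; ring
    · rw [intervalIntegral.integral_const_mul, integral_pow, Nat.factorial_succ]
      have : ((n : ℝ) + 1) ≠ 0 := by positivity
      have h2 : (n.factorial : ℝ) ≠ 0 := by positivity
      push_cast
      field_simp
      ring

/-- The solutions of a random differential equation depend measurably on the random parameter, as
limits of Picard iterates. -/
theorem measurable_isSolution {M : Type*} [MeasurableSpace M] {F : ℝ → M → E → E}
    (hF : Measurable fun p : (ℝ × M) × E => F p.1.1 p.1.2 p.2) {C K : ℝ}
    (hC : ∀ s ω y, ‖F s ω y‖ ≤ C) (hK : 0 ≤ K)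
    (hlip : ∀ s ω y z, ‖F s ω y - F s ω z‖ ≤ K * ‖y - z‖) {x : E} {X : M → ℝ → E}
    (hX : ∀ ω, IsSolution (fun s => F s ω) x (X ω)) {t : ℝ} (ht : 0 ≤ t) :
    Measurable fun ω => X ω t := by
  refine measurable_of_tendsto_metrizable (f := fun n ω => picardIterate F x n t ω) (fun n =>
    (measurable_picardIterate hF x n).comp (by fun_prop : Measurable fun ω : M => (t, ω))) ?_
  refine tendsto_pi_nhds.2 fun ω => tendsto_iff_norm_sub_tendsto_zero.2 ?_
  refine squeeze_zero (fun _ => norm_nonneg _)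
    (fun n => norm_picardIterate_sub_le hF hC hK hlip (hX ω) n t ht le_rfl) ?_
  simpa using (FloorSemiring.tendsto_pow_div_factorial_atTop (K * t)).const_mul (C * t)

end Solutions

/-! ### Optimal Lipschitz constants -/

section LipConst

variable {E F : Type*} [NormedAddCommGroup E] [NormedAddCommGroup F]

theorem lipConst_nonneg (g : E → F) : 0 ≤ lipConst g :=
  Real.sInf_nonneg fun _ hK => hK.1

theorem lipConst_le {g : E → F} {K : ℝ} (hK : 0 ≤ K) (h : ∀ x y, ‖g x - g y‖ ≤ K * ‖x - y‖) :
    lipConst g ≤ K :=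
  csInf_le ⟨0, fun _ hK => hK.1⟩ ⟨hK, h⟩

theorem norm_sub_le_lipConst_mul {g : E → F} {K : ℝ} (hK : 0 ≤ K)
    (h : ∀ x y, ‖g x - g y‖ ≤ K * ‖x - y‖) (x y : E) :
    ‖g x - g y‖ ≤ lipConst g * ‖x - y‖ := by
  rcases eq_or_ne x y with rfl | hxy
  · simp
  have hpos : 0 < ‖x - y‖ := norm_pos_iff.2 (sub_ne_zero.2 hxy)
  rw [← div_le_iff₀ hpos]
  exact le_csInf ⟨K, hK, h⟩ fun K' hK' => (div_le_iff₀ hpos).2 (hK'.2 x y)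

/-- The optimal Lipschitz constant of a random Lipschitz map is measurable, since it is determined
by the values on a countable dense set. -/
theorem measurable_lipConst {M : Type*} [MeasurableSpace M] [MeasurableSpace E]
    [SecondCountableTopology E] [MeasurableSpace F] [BorelSpace F] [SecondCountableTopology F]
    {f : E → M → F} (hf : ∀ x, Measurable (f x)) {K : ℝ} (hK : 0 ≤ K)
    (h : ∀ ω x y, ‖f x ω - f y ω‖ ≤ K * ‖x - y‖) : Measurable fun ω => lipConst fun x => f x ω := by
  refine measurable_of_Iic fun c => ?_
  rcases lt_or_ge c 0 with hc | hc
  · convert MeasurableSet.empty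
    refine eq_empty_of_forall_notMem fun ω hω => ?_
    exact absurd ((lipConst_nonneg _).trans hω) (not_le.2 hc)
  obtain ⟨D, hDc, hD⟩ := TopologicalSpace.exists_countable_dense E
  have hcont : ∀ ω, Continuous fun x => f x ω := fun ω =>
    (LipschitzWith.of_dist_le' (K := K) fun x y => by
      simpa [dist_eq_norm] using h ω x y).continuous
  have key : (fun ω => lipConst fun x => f x ω) ⁻¹' Iic c =
      ⋂ x ∈ D, ⋂ y ∈ D, {ω | ‖f x ω - f y ω‖ ≤ c * ‖x - y‖} := by
    ext ω
    simp only [mem_preimage, mem_Iic, mem_iInter, mem_ofPred_eq]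
    constructor
    · exact fun hω x _ y _ => (norm_sub_le_lipConst_mul hK (h ω) x y).trans
        (mul_le_mul_of_nonneg_right hω (norm_nonneg _))
    · intro hω
      refine lipConst_le hc fun x y => ?_
      have hcl : IsClosed {p : E × E | ‖f p.1 ω - f p.2 ω‖ ≤ c * ‖p.1 - p.2‖} :=
        isClosed_le (((hcont ω).comp continuous_fst).sub ((hcont ω).comp continuous_snd)).norm
          (continuous_const.mul (continuous_fst.sub continuous_snd).norm)
      have : (univ : Set (E × E)) ⊆ {p : E × E | ‖f p.1 ω - f p.2 ω‖ ≤ c * ‖p.1 - p.2‖} := by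
        rw [← (hD.prod hD).closure_eq]
        exact closure_minimal (fun p hp => hω p.1 hp.1 p.2 hp.2) hcl
      exact this (mem_univ (x, y))
  rw [key]
  exact MeasurableSet.biInter hDc fun x _ => MeasurableSet.biInter hDc fun y _ =>
    measurableSet_le ((hf x).sub (hf y)).norm measurable_const

end LipConst

/-! ### Pathwise estimates for the perturbed equation -/

section TwiceDiff

variable {E : Type*} [NormedAddCommGroup E] [NormedSpace ℝ E]

theorem TwiceDiffBounded.mono {g : E → E} {C C' : ℝ} (h : TwiceDiffBounded g C) (hC : C ≤ C') :
    TwiceDiffBounded g C' :=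
  ⟨h.1, h.2, fun x => (h.3 x).trans hC, fun x => (h.4 x).trans hC, fun x => (h.5 x).trans hC⟩

theorem TwiceDiffBounded.norm_sub_le {g : E → E} {C : ℝ} (h : TwiceDiffBounded g C) (x y : E) :
    ‖g x - g y‖ ≤ C * ‖x - y‖ :=
  convex_univ.norm_image_sub_le_of_norm_fderiv_le (fun z _ => h.differentiable z)
    (fun z _ => h.bound_fderiv z) (mem_univ y) (mem_univ x)

/-- The remainder of order two in Taylor's formula. -/
theorem TwiceDiffBounded.norm_sub_sub_le {g : E → E} {C : ℝ} (h : TwiceDiffBounded g C) (x y : E) :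
    ‖g x - g y - fderiv ℝ g y (x - y)‖ ≤ C * ‖x - y‖ ^ 2 := by
  have hC : 0 ≤ C := (norm_nonneg _).trans (h.bound y)
  have h1 : ∀ z ∈ segment ℝ y x, ‖fderiv ℝ g z - fderiv ℝ g y‖ ≤ C * ‖x - y‖ := fun z hz => by
    refine (convex_univ.norm_image_sub_le_of_norm_fderiv_le
      (fun z _ => h.differentiable_fderiv z) (fun z _ => h.bound_fderiv_fderiv z) (mem_univ y)
      (mem_univ z)).trans (mul_le_mul_of_nonneg_left ?_ hC)
    exact norm_sub_le_of_mem_segment hz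
  have := (convex_segment y x).norm_image_sub_le_of_norm_hasFDerivWithin_le'
    (fun z _ => (h.differentiable z).hasFDerivAt.hasFDerivWithinAt) h1
    (left_mem_segment ℝ y x) (right_mem_segment ℝ y x)
  exact this.trans (le_of_eq (by ring))

theorem TwiceDiffBounded.continuous_fderiv {g : E → E} {C : ℝ} (h : TwiceDiffBounded g C) :
    Continuous (fderiv ℝ g) :=
  h.differentiable_fderiv.continuous

end TwiceDiff

section Pathwise

variable {E : Type*} [NormedAddCommGroup E] [NormedSpace ℝ E] [SecondCountableTopology E]
  [MeasurableSpace E] [BorelSpace E] {k : ℝ → E → E} {fbar : E → E} {ℓ G : ℝ → ℝ}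
  {C D T : ℝ} {x : E} {W X : ℝ → E}

/-- The size of the error `X - W` is controlled by the integral of a majorant of the perturbation
along the unperturbed solution. -/
theorem norm_sub_le_of_perturbed (hk : Measurable (Function.uncurry k)) (hkC : ∀ s y, ‖k s y‖ ≤ C)
    (hℓC : ∀ s, ℓ s ≤ C) (hklip : ∀ s y z, ‖k s y - k s z‖ ≤ ℓ s * ‖y - z‖)
    (hfbar : TwiceDiffBounded fbar C) (hW : IsSolution (fun _ y => fbar y) x W)
    (hX : IsSolution (fun s y => k s y + fbar y) x X)
    (hG : Measurable G) (hG0 : ∀ s, 0 ≤ G s) (hGD : ∀ s, G s ≤ D)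
    (hkG : ∀ s, 0 ≤ s → s ≤ T → ‖k s (W s)‖ ≤ G s) {t : ℝ} (ht : 0 ≤ t) (htT : t ≤ T) :
    ‖X t - W t‖ ≤ Real.exp (2 * C * T) * ∫ s in (0 : ℝ)..T, G s := by
  have hC0 : 0 ≤ C := (norm_nonneg _).trans (hfbar.bound x)
  have hfm : Measurable (Function.uncurry fun (_ : ℝ) y => fbar y) :=
    hfbar.differentiable.continuous.measurable.comp measurable_snd
  have hGi : ∀ a b, IntervalIntegrable G volume a b := fun a b => by
    rw [intervalIntegrable_iff]
    exact IntegrableOn.of_bound (by simp) hG.aestronglyMeasurable D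
      (ae_of_all _ fun s => by rw [Real.norm_of_nonneg (hG0 s)]; exact hGD s)
  have hcont : ContinuousOn (fun t => ‖X t - W t‖) (Ici 0) := (hX.1.sub hW.1).norm
  have hci : ∀ t, 0 ≤ t → IntervalIntegrable (fun t => ‖X t - W t‖) volume 0 t := fun t ht =>
    (hcont.mono (by rw [uIcc_of_le ht]; exact fun s hs => hs.1)).intervalIntegrable
  have key : ∀ t, 0 ≤ t → t ≤ T → ‖X t - W t‖ ≤
      (∫ s in (0 : ℝ)..T, G s) + 2 * C * ∫ s in (0 : ℝ)..t, ‖X s - W s‖ := by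
    intro t ht htT
    have hGt : ∫ s in (0 : ℝ)..t, G s ≤ ∫ s in (0 : ℝ)..T, G s :=
      intervalIntegral.integral_mono_interval le_rfl ht htT (ae_of_all _ hG0) (hGi _ _)
    rw [hX.2 t ht, hW.2 t ht, add_sub_add_left_eq_sub, ← intervalIntegral.integral_sub
      (hX.intervalIntegrable (H := fun s y => k s y + fbar y) (hk.add hfm) (C := C + C)
        (fun s y => (norm_add_le _ _).trans (add_le_add (hkC s y) (hfbar.bound y))) ht)
      (hW.intervalIntegrable hfm (fun s y => hfbar.bound y) ht)]
    refine (intervalIntegral.norm_integral_le_of_norm_le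
      (g := fun s => G s + 2 * C * ‖X s - W s‖) ht (ae_of_all _ fun s hs => ?_)
      ((hGi _ _).add ((hci t ht).const_mul _))).trans ?_
    · have e : k s (X s) + fbar (X s) - fbar (W s) =
          k s (W s) + (k s (X s) - k s (W s)) + (fbar (X s) - fbar (W s)) := by abel
      rw [e]
      refine (norm_add₃_le).trans ?_
      have h1 := hkG s hs.1.le (hs.2.trans htT)
      have h2 := (hklip s (X s) (W s)).trans
        (mul_le_mul_of_nonneg_right (hℓC s) (norm_nonneg _))
      have h3 := hfbar.norm_sub_le (X s) (W s)
      linarith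
    · rw [intervalIntegral.integral_add (hGi _ _) ((hci t ht).const_mul _),
        intervalIntegral.integral_const_mul]
      linarith
  refine (le_mul_exp_of_le_add_mul_integral hcont (by positivity) key ht htT).trans ?_
  rw [mul_comm]
  have : 0 ≤ ∫ s in (0 : ℝ)..T, G s :=
    intervalIntegral.integral_nonneg (ht.trans htT) fun s _ => hG0 s
  gcongr

/-- The error `X - W` solves the linearised equation driven by `∫ k s (W s) ds`, up to a
remainder that is quadratic in the size of the perturbation. -/
theorem norm_remainder_le_of_perturbed (hk : Measurable (Function.uncurry k))
    (hkC : ∀ s y, ‖k s y‖ ≤ C) (hℓ0 : ∀ s, 0 ≤ ℓ s)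
    (hℓC : ∀ s, ℓ s ≤ C) (hklip : ∀ s y z, ‖k s y - k s z‖ ≤ ℓ s * ‖y - z‖)
    (hfbar : TwiceDiffBounded fbar C) (hW : IsSolution (fun _ y => fbar y) x W)
    (hX : IsSolution (fun s y => k s y + fbar y) x X)
    (hG : Measurable G) (hG0 : ∀ s, 0 ≤ G s) (hGD : ∀ s, G s ≤ D) (hℓG : ∀ s, ℓ s ≤ G s)
    (hkG : ∀ s, 0 ≤ s → s ≤ T → ‖k s (W s)‖ ≤ G s) {t : ℝ} (ht : 0 ≤ t) (htT : t ≤ T) :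
    ‖X t - W t - (∫ s in (0 : ℝ)..t, fderiv ℝ fbar (W s) (X s - W s)) -
      ∫ s in (0 : ℝ)..t, k s (W s)‖ ≤
      (Real.exp (2 * C * T) + C * T * Real.exp (2 * C * T) ^ 2) *
        (∫ s in (0 : ℝ)..T, G s) ^ 2 := by
  have hC0 : 0 ≤ C := (norm_nonneg _).trans (hfbar.bound x)
  have hfm : Measurable (Function.uncurry fun (_ : ℝ) y => fbar y) :=
    hfbar.differentiable.continuous.measurable.comp measurable_snd
  have hGi : ∀ a b, IntervalIntegrable G volume a b := fun a b => by
    rw [intervalIntegrable_iff]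
    exact IntegrableOn.of_bound (by simp) hG.aestronglyMeasurable D
      (ae_of_all _ fun s => by rw [Real.norm_of_nonneg (hG0 s)]; exact hGD s)
  have hsub : uIcc 0 t ⊆ Ici 0 := by rw [uIcc_of_le ht]; exact fun s hs => hs.1
  have i1 := hX.intervalIntegrable (H := fun s y => k s y + fbar y) (hk.add hfm) (C := C + C)
        (fun s y => (norm_add_le _ _).trans (add_le_add (hkC s y) (hfbar.bound y))) ht
  have i2 := hW.intervalIntegrable hfm (fun s y => hfbar.bound y) ht
  have i3 : IntervalIntegrable (fun s => fderiv ℝ fbar (W s) (X s - W s)) volume 0 t :=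
    (((hfbar.continuous_fderiv.comp_continuousOn hW.1).clm_apply (hX.1.sub hW.1)).mono
      hsub).intervalIntegrable
  have i4 := hW.intervalIntegrable hk hkC ht
  set S := ∫ s in (0 : ℝ)..T, G s
  set c := Real.exp (2 * C * T)
  have hc0 : 0 ≤ c := (Real.exp_pos _).le
  have hS0 : 0 ≤ S := intervalIntegral.integral_nonneg (ht.trans htT) fun s _ => hG0 s
  have e : X t - W t - (∫ s in (0 : ℝ)..t, fderiv ℝ fbar (W s) (X s - W s)) -
      ∫ s in (0 : ℝ)..t, k s (W s) = ∫ s in (0 : ℝ)..t, (k s (X s) + fbar (X s) - fbar (W s) -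
        fderiv ℝ fbar (W s) (X s - W s) - k s (W s)) := by
    rw [intervalIntegral.integral_sub ((i1.sub i2).sub i3) i4,
      intervalIntegral.integral_sub (i1.sub i2) i3, intervalIntegral.integral_sub i1 i2]
    congr 2
    conv_lhs => rw [hX.2 t ht, hW.2 t ht]
    abel
  rw [e]
  refine (intervalIntegral.norm_integral_le_of_norm_le
    (g := fun s => c * S * G s + C * (c * S) ^ 2) ht (ae_of_all _ fun s hs => ?_)
    (((hGi _ _).const_mul _).add intervalIntegrable_const)).trans ?_
  · have hE := norm_sub_le_of_perturbed hk hkC hℓC hklip hfbar hW hX hG hG0 hGD hkG hs.1.le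
      (hs.2.trans htT)
    have e2 : k s (X s) + fbar (X s) - fbar (W s) - fderiv ℝ fbar (W s) (X s - W s) - k s (W s) =
        (k s (X s) - k s (W s)) +
          (fbar (X s) - fbar (W s) - fderiv ℝ fbar (W s) (X s - W s)) := by abel
    rw [e2]
    refine (norm_add_le _ _).trans (add_le_add ?_ ?_)
    · refine (hklip _ _ _).trans ?_
      rw [mul_comm]
      exact mul_le_mul hE (hℓG s) (hℓ0 s) (by positivity)
    · exact (hfbar.norm_sub_sub_le _ _).trans (by gcongr)
  · rw [intervalIntegral.integral_add ((hGi _ _).const_mul _) intervalIntegrable_const,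
      intervalIntegral.integral_const_mul, intervalIntegral.integral_const, smul_eq_mul, sub_zero]
    have hGt : ∫ s in (0 : ℝ)..t, G s ≤ S :=
      intervalIntegral.integral_mono_interval le_rfl ht htT (ae_of_all _ hG0) (hGi _ _)
    have h1 : c * S * ∫ s in (0 : ℝ)..t, G s ≤ c * S * S := by gcongr
    have h2 : t * (C * (c * S) ^ 2) ≤ T * (C * (c * S) ^ 2) := by gcongr
    calc _ ≤ c * S * S + T * (C * (c * S) ^ 2) := add_le_add h1 h2
      _ = _ := by ring

end Pathwise

/-! ### Approximation of integrals by sums over a grid -/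

/-- The `i`-th point of the grid of mesh `1/n`, stopped at `t`. -/
noncomputable def gridPoint (n : ℕ) (t : ℝ) (i : ℕ) : ℝ := min ((i : ℝ) / n) t

theorem gridPoint_mono (n : ℕ) (t : ℝ) : Monotone (gridPoint n t) := fun i j hij =>
  min_le_min_right _ (by gcongr)

theorem gridPoint_nonneg (n : ℕ) {t : ℝ} (ht : 0 ≤ t) (i : ℕ) : 0 ≤ gridPoint n t i :=
  le_min (by positivity) ht

theorem gridPoint_le (n : ℕ) (t : ℝ) (i : ℕ) : gridPoint n t i ≤ t := min_le_right _ _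

theorem gridPoint_zero (n : ℕ) {t : ℝ} (ht : 0 ≤ t) : gridPoint n t 0 = 0 := by
  simp [gridPoint, ht]

theorem gridPoint_mul_self {n : ℕ} {t : ℝ} (ht : t ≤ n) (hn : 0 < n) :
    gridPoint n t (n * n) = t := by
  have : ((n : ℝ)) ≠ 0 := by positivity
  simp [gridPoint, ht, this]

theorem uIcc_gridPoint_subset (n : ℕ) {t : ℝ} (ht : 0 ≤ t) (i : ℕ) :
    uIcc (gridPoint n t i) (gridPoint n t (i + 1)) ⊆ uIcc 0 t := by
  rw [uIcc_of_le ht]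
  exact uIcc_subset_Icc ⟨gridPoint_nonneg n ht i, gridPoint_le n t i⟩
    ⟨gridPoint_nonneg n ht _, gridPoint_le n t _⟩

theorem integral_eq_sum_gridPoint {E : Type*} [NormedAddCommGroup E] [NormedSpace ℝ E]
    {μ : Measure ℝ} {u : ℝ → E} {n : ℕ} {t : ℝ} (hn : 0 < n) (ht : 0 ≤ t) (htn : t ≤ n)
    (hu : IntervalIntegrable u μ 0 t) :
    ∫ s in (0 : ℝ)..t, u s ∂μ = ∑ i ∈ Finset.range (n * n),
      ∫ s in (gridPoint n t i)..(gridPoint n t (i + 1)), u s ∂μ := by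
  rw [intervalIntegral.sum_integral_adjacent_intervals fun i _ =>
    hu.mono_set (uIcc_gridPoint_subset n ht i), gridPoint_zero n ht, gridPoint_mul_self htn hn]

/-- The error made in an integral over `[0,t]` by replacing the integrand on each interval of the
grid; the first `n²` intervals of mesh `1/n` cover `[0,n]`. -/
theorem norm_integral_sub_sum_grid_le {E : Type*} [NormedAddCommGroup E] [NormedSpace ℝ E]
    {μ : Measure ℝ} {u : ℝ → E} {c : ℕ → ℝ → E} {ρ : ℝ → ℝ} {n : ℕ} {t : ℝ} (hn : 0 < n)
    (ht : 0 ≤ t) (htn : t ≤ n) (hu : IntervalIntegrable u μ 0 t)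
    (hc : ∀ i, IntervalIntegrable (c i) μ 0 t) (hρ : IntervalIntegrable ρ μ 0 t)
    (h : ∀ i : ℕ, ∀ s, (i : ℝ) / n < s → s ≤ ((i : ℝ) + 1) / n → s ≤ t → ‖u s - c i s‖ ≤ ρ s) :
    ‖(∫ s in (0 : ℝ)..t, u s ∂μ) - ∑ i ∈ Finset.range (n * n),
      ∫ s in (gridPoint n t i)..(gridPoint n t (i + 1)), c i s ∂μ‖ ≤ ∫ s in (0 : ℝ)..t, ρ s ∂μ := by
  have hsub := uIcc_gridPoint_subset n ht
  rw [integral_eq_sum_gridPoint hn ht htn hu, ← Finset.sum_sub_distrib,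
    integral_eq_sum_gridPoint hn ht htn hρ]
  refine (norm_sum_le _ _).trans (Finset.sum_le_sum fun i _ => ?_)
  rw [← intervalIntegral.integral_sub (hu.mono_set (hsub i)) ((hc i).mono_set (hsub i))]
  refine intervalIntegral.norm_integral_le_of_norm_le (gridPoint_mono n t (Nat.le_succ i))
    (ae_of_all _ fun s hs => ?_) (hρ.mono_set (hsub i))
  have hst : s ≤ t := hs.2.trans (gridPoint_le _ _ _)
  refine h i s ?_ ?_ hst
  · rcases min_lt_iff.1 hs.1 with h' | h'
    · exact h'
    · exact absurd hst (not_le.2 h')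
  · have := hs.2.trans (min_le_left _ _)
    push_cast at this
    exact this

/-! ### Riemann–Stieltjes sums -/

theorem toPath_apply {E : Type*} [TopologicalSpace E] [Zero E] {u : ℝ → E}
    (hu : ContinuousOn u (Ici 0)) (t : ℝ≥0) : toPath u t = u t :=
  ContinuousMap.mkD_apply_of_continuous
    (hu.comp_continuous NNReal.continuous_coe fun t => t.coe_nonneg)

/-- The `i`-th grid point stopped at `t`, as a continuous function of `t`. -/
noncomputable def gridPath (n i : ℕ) : C(ℝ≥0, ℝ≥0) where
  toFun t := (gridPoint n t i).toNNReal
  continuous_toFun :=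
    continuous_real_toNNReal.comp (continuous_const.min NNReal.continuous_coe)

theorem norm_sub_le_of_gridPoint {E : Type*} [NormedAddCommGroup E] {u : ℝ → E} {K : ℝ} (hK : 0 ≤ K)
    (hu : ∀ r s, 0 ≤ r → r ≤ s → ‖u s - u r‖ ≤ K * (s - r)) {n i : ℕ} {s : ℝ}
    (h1 : (i : ℝ) / n < s) (h2 : s ≤ ((i : ℝ) + 1) / n) : ‖u s - u ((i : ℝ) / n)‖ ≤ K / n := by
  refine (hu _ _ (by positivity) h1.le).trans ?_
  rw [div_eq_mul_one_div K]
  refine mul_le_mul_of_nonneg_left ?_ hK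
  rw [add_div] at h2
  linarith

section RiemannSum

variable {E : Type*} [NormedAddCommGroup E] [NormedSpace ℝ E]

/-- The Riemann–Stieltjes sums of `∫_0^t u_s dz_s` over the first `n²` intervals of the grid of
mesh `1/n`, with the value `q i` of `u` at the `i`-th grid point. -/
noncomputable def riemannStieltjesSum (n : ℕ) (q : ℕ → E) (z : C(ℝ≥0, ℝ)) : C(ℝ≥0, E) :=
  ∑ i ∈ Finset.range (n * n),
    (⟨fun r : ℝ => r • q i, by fun_prop⟩ : C(ℝ, E)).comp
      (z.comp (gridPath n (i + 1)) - z.comp (gridPath n i))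

theorem continuous_riemannStieltjesSum (n : ℕ) (q : ℕ → E) :
    Continuous (riemannStieltjesSum n q) :=
  continuous_finsetSum _ fun _ _ => (ContinuousMap.continuous_postcomp _).comp
    ((ContinuousMap.continuous_precomp _).sub (ContinuousMap.continuous_precomp _))

theorem riemannStieltjesSum_apply (n : ℕ) (q : ℕ → E) (z : C(ℝ≥0, ℝ)) (t : ℝ≥0) :
    riemannStieltjesSum n q z t = ∑ i ∈ Finset.range (n * n),
      (z (gridPoint n t (i + 1)).toNNReal - z (gridPoint n t i).toNNReal) • q i := by
  simp [riemannStieltjesSum, ContinuousMap.sum_apply, gridPath]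

variable [CompleteSpace E]

/-- The Riemann–Stieltjes sums approximate the Stieltjes integral of a Lipschitz function. -/
theorem norm_stieltjesIntegral_sub_le {u : ℝ → E} {K : ℝ} (hK : 0 ≤ K)
    (hu : ∀ r s, 0 ≤ r → r ≤ s → ‖u s - u r‖ ≤ K * (s - r)) {z : ℝ → ℝ}
    (hc : ContinuousOn z (Ici 0)) (hm : MonotoneOn z (Ici 0)) {n : ℕ} (hn : 0 < n) {t : ℝ≥0}
    (htn : t ≤ n) :
    ‖stieltjesIntegral u z hc hm t -
      riemannStieltjesSum n (fun i => u ((i : ℝ) / n)) (toPath z) t‖ ≤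
      K / n * (z t - z 0) := by
  set F := increasingStieltjes z hc hm
  have htn' : (t : ℝ) ≤ n := by exact_mod_cast htn
  have hF : ∀ a b, 0 ≤ a → a ≤ b → F.measure.real (Ioc a b) = z b - z a := by
    intro a b ha hab
    rw [Measure.real, StieltjesFunction.measure_Ioc, ENNReal.toReal_ofReal]
    · change z (max b 0) - z (max a 0) = _
      rw [max_eq_left ha, max_eq_left (ha.trans hab)]
    · exact sub_nonneg.2 (F.mono hab)
  have hint : IntervalIntegrable u F.measure 0 t := by
    refine ContinuousOn.intervalIntegrable ?_
    have : LipschitzOnWith (Real.toNNReal K) u (Ici 0) := by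
      refine LipschitzOnWith.of_dist_le' fun r hr s hs => ?_
      rw [dist_eq_norm, Real.dist_eq]
      rcases le_total r s with h | h
      · rw [norm_sub_rev, abs_sub_comm, abs_of_nonneg (sub_nonneg.2 h)]
        exact hu r s hr h
      · rw [abs_of_nonneg (sub_nonneg.2 h)]
        exact hu s r hs h
    refine this.continuousOn.mono ?_
    rw [uIcc_of_le t.coe_nonneg]
    exact fun s hs => hs.1
  have key := norm_integral_sub_sum_grid_le (μ := F.measure) (u := u)
    (c := fun i _ => u ((i : ℝ) / n)) (ρ := fun _ => K / n) hn t.coe_nonneg htn' hint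
    (fun i => intervalIntegrable_const) intervalIntegrable_const
    (fun i s h1 h2 _ => norm_sub_le_of_gridPoint hK hu h1 h2)
  rw [intervalIntegral.integral_of_le t.coe_nonneg, intervalIntegral.integral_of_le t.coe_nonneg,
    setIntegral_const, hF 0 t le_rfl t.coe_nonneg, smul_eq_mul, mul_comm (z t - z 0)] at key
  convert key using 3
  · rfl
  rw [riemannStieltjesSum_apply]
  refine Finset.sum_congr rfl fun i _ => ?_
  have h0 := gridPoint_nonneg n t.coe_nonneg i
  have h1 := gridPoint_mono n (t : ℝ) (Nat.le_succ i)
  rw [intervalIntegral.integral_of_le h1, setIntegral_const, hF _ _ h0 h1, toPath_apply hc,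
    toPath_apply hc, Real.coe_toNNReal _ h0, Real.coe_toNNReal _ (h0.trans h1)]

theorem tendsto_riemannStieltjesSum {u : ℝ → E} {K : ℝ} (hK : 0 ≤ K)
    (hu : ∀ r s, 0 ≤ r → r ≤ s → ‖u s - u r‖ ≤ K * (s - r)) {z : ℝ → ℝ}
    (hc : ContinuousOn z (Ici 0)) (hm : MonotoneOn z (Ici 0)) (T : ℝ≥0) {η : ℝ} (hη : 0 < η) :
    ∀ᶠ n in atTop, ∀ t ≤ T, dist (riemannStieltjesSum n (fun i => u ((i : ℝ) / n)) (toPath z) t)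
      (stieltjesIntegral u z hc hm t) < η := by
  have hlim : Tendsto (fun n : ℕ => K / n * (z T - z 0)) atTop (𝓝 0) := by
    simpa using (tendsto_const_div_atTop_nhds_zero_nat K).mul_const (z T - z 0)
  filter_upwards [hlim.eventually_lt_const hη, eventually_ge_atTop ⌈T⌉₊, eventually_gt_atTop 0]
    with n hn hnT hn0 t ht
  rw [dist_comm, dist_eq_norm]
  refine (norm_stieltjesIntegral_sub_le hK hu hc hm hn0
    (ht.trans (Nat.ceil_le.1 hnT))).trans_lt (lt_of_le_of_lt ?_ hn)
  have : z t ≤ z T := hm t.coe_nonneg T.coe_nonneg (by exact_mod_cast ht)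
  gcongr

/-- The indefinite Stieltjes integral of a Lipschitz function is continuous. -/
theorem continuousOn_stieltjesIntegral {u : ℝ → E} {K : ℝ} (hK : 0 ≤ K)
    (hu : ∀ r s, 0 ≤ r → r ≤ s → ‖u s - u r‖ ≤ K * (s - r)) {z : ℝ → ℝ}
    (hc : ContinuousOn z (Ici 0)) (hm : MonotoneOn z (Ici 0)) :
    ContinuousOn (stieltjesIntegral u z hc hm) (Ici 0) := by
  have h : Continuous fun t : ℝ≥0 => stieltjesIntegral u z hc hm t := by
    refine TendstoLocallyUniformly.continuous (p := atTop)
      (F := fun (n : ℕ) (t : ℝ≥0) =>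
        riemannStieltjesSum n (fun i => u ((i : ℝ) / n)) (toPath z) t) ?_
      (Frequently.of_forall fun n => map_continuous _)
    refine tendstoLocallyUniformly_iff_forall_isCompact.2 fun Q hQ => ?_
    obtain ⟨T, hT⟩ := hQ.bddAbove
    refine Metric.tendstoUniformlyOn_iff.2 fun η hη => ?_
    filter_upwards [tendsto_riemannStieltjesSum hK hu hc hm T hη] with n hn t ht
    rw [dist_comm]
    exact hn t (hT ht)
  have h2 := h.comp continuous_real_toNNReal
  refine h2.continuousOn.congr fun t ht => ?_
  simp only [Function.comp, Real.coe_toNNReal t ht]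

theorem tendsto_riemannStieltjesSum_path {u : ℝ → E} {K : ℝ} (hK : 0 ≤ K)
    (hu : ∀ r s, 0 ≤ r → r ≤ s → ‖u s - u r‖ ≤ K * (s - r)) {z : ℝ → ℝ}
    (hc : ContinuousOn z (Ici 0)) (hm : MonotoneOn z (Ici 0)) :
    Tendsto (fun n : ℕ => riemannStieltjesSum n (fun i => u ((i : ℝ) / n)) (toPath z)) atTop
      (𝓝 (toPath (stieltjesIntegral u z hc hm))) := by
  refine tendsto_path_iff.2 fun T η hη => ?_
  filter_upwards [tendsto_riemannStieltjesSum hK hu hc hm T hη] with n hn t ht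
  rw [toPath_apply (continuousOn_stieltjesIntegral hK hu hc hm)]
  exact hn t ht

end RiemannSum

/-! ### Occupation integrals along the flow -/

section Flow

variable {M : Type*} [MeasurableSpace M] {φ : ℝ → M → M}

/-- The flow `s ↦ φ_{s/ε}`, extended to negative times by its value at time `0`. -/
noncomputable def scaledFlow {M : Type*} (φ : ℝ → M → M) (ε s : ℝ) (ω : M) : M :=
  φ (max s 0 / ε) ω

theorem measurable_scaledFlow (hφ : IsMeasurableFlow φ) {ε : ℝ} (hε : 0 < ε) :
    Measurable fun p : ℝ × M => scaledFlow φ ε p.1 p.2 := by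
  have : Measurable fun p : ℝ × M => ((p.1 / ε).toNNReal, p.2) := by fun_prop
  convert hφ.measurable.comp this using 2 with p
  simp only [scaledFlow, Function.comp, Real.coe_toNNReal', max_div_div_right hε.le p.1 0 |>.symm,
    zero_div]

theorem mul_integral_flow_eq {M : Type*} {φ : ℝ → M → M} {ε t : ℝ} (hε : 0 < ε) (ht : 0 ≤ t)
    (c : ℝ) (g : M → ℝ) (ω : M) :
    c * ∫ s in (0 : ℝ)..(t / ε), g (φ s ω) =
      c / ε * ∫ s in (0 : ℝ)..t, g (scaledFlow φ ε s ω) := by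
  have : ∫ s in (0 : ℝ)..t, g (scaledFlow φ ε s ω) = ∫ s in (0 : ℝ)..t, g (φ (s / ε) ω) :=
    intervalIntegral.integral_congr fun s hs => by
      rw [uIcc_of_le ht] at hs
      simp only [scaledFlow, max_eq_left hs.1]
  rw [this, intervalIntegral.integral_comp_div (fun s => g (φ s ω)) hε.ne', zero_div, smul_eq_mul]
  field_simp

theorem intervalIntegrable_scaledFlow {F : Type*} [NormedAddCommGroup F]
    [MeasurableSpace F] [BorelSpace F] [SecondCountableTopology F] (hφ : IsMeasurableFlow φ)
    {ε : ℝ} (hε : 0 < ε) {g : M → F} (hg : Measurable g) {D : ℝ} (hD : ∀ ω, ‖g ω‖ ≤ D) (ω : M)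
    (a b : ℝ) : IntervalIntegrable (fun s => g (scaledFlow φ ε s ω)) volume a b := by
  rw [intervalIntegrable_iff]
  refine IntegrableOn.of_bound (by simp) ?_ D (ae_of_all _ fun s => hD _)
  exact (hg.comp ((measurable_scaledFlow hφ hε).comp
    (by fun_prop : Measurable fun s : ℝ => (s, ω)))).aestronglyMeasurable

theorem toPath_integral_flow_apply (hφ : IsMeasurableFlow φ) {ε : ℝ} (hε : 0 < ε) {g : M → ℝ}
    (hg : Measurable g) {D : ℝ} (hD : ∀ ω, ‖g ω‖ ≤ D) (c : ℝ) (ω : M) (t : ℝ≥0) :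
    toPath (fun t => c * ∫ s in (0 : ℝ)..(t / ε), g (φ s ω)) t =
      c / ε * ∫ s in (0 : ℝ)..t, g (scaledFlow φ ε s ω) := by
  rw [toPath_apply, mul_integral_flow_eq hε t.coe_nonneg]
  have : Continuous fun t => c / ε * ∫ s in (0 : ℝ)..t, g (scaledFlow φ ε s ω) :=
    continuous_const.mul (intervalIntegral.continuous_primitive
      (fun a b => intervalIntegrable_scaledFlow hφ hε hg hD ω a b) 0)
  exact this.continuousOn.congr fun t ht => mul_integral_flow_eq hε ht c g ω

end Flow

/-! ### Consequences of the functional law of large numbers -/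

/-- The filter `ε → 0+` on the positive reals. -/
abbrev zeroPlus : Filter (Ioi (0 : ℝ)) := comap Subtype.val (𝓝 (0 : ℝ))

/-- The functional law of large numbers under the probability measure `P`: the rescaled occupation
integrals of every integrable function `g` converge in distribution to `(∫ g dν) Z` on compact time
intervals. -/
def FunctionalLLN {M Ω : Type*} [MeasurableSpace M] [MeasurableSpace Ω] (φ : ℝ → M → M)
    (ν P : Measure M) [IsProbabilityMeasure P] (a : ℝ → ℝ) (Z : Ω → ℝ → ℝ) (ℙ : Measure Ω)
    [IsProbabilityMeasure ℙ] : Prop :=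
  ∀ g : M → ℝ, Integrable g ν → ∀ T : ℝ≥0, TendstoInDistribution
    (fun (ε : Ioi (0 : ℝ)) (ω : M) => restrictPath T
      (toPath fun t => a ε * ∫ s in (0 : ℝ)..(t / ε), g (φ s ω))) zeroPlus
    (fun ω' => restrictPath T (toPath fun t => (∫ ω, g ω ∂ν) * Z ω' t)) (fun _ => P) ℙ

theorem exists_measurableSet_lt_measure {M : Type*} [MeasurableSpace M] {ν : Measure M}
    [SigmaFinite ν] (hν : ν univ = ⊤) (n : ℕ) :
    ∃ A, MeasurableSet A ∧ (n : ℝ) < ν.real A ∧ ν A < ⊤ := by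
  obtain ⟨A, hA, -, hn, htop⟩ := Measure.exists_subset_measure_lt_top (μ := ν) (r := n)
    MeasurableSet.univ (by simp [hν])
  refine ⟨A, hA, ?_, htop⟩
  rw [Measure.real, ← ENNReal.toReal_natCast]
  exact (ENNReal.toReal_lt_toReal (by simp) htop.ne).2 hn

namespace FunctionalLLN

variable {M Ω : Type*} [MeasurableSpace M] [MeasurableSpace Ω] {φ : ℝ → M → M}
  {ν P : Measure M} [IsProbabilityMeasure P] {a : ℝ → ℝ} {Z : Ω → ℝ → ℝ} {ℙ : Measure Ω}
  [IsProbabilityMeasure ℙ]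

theorem tendsto_path (h : FunctionalLLN φ ν P a Z ℙ) {g : M → ℝ} (hg : Integrable g ν) :
    TendstoInDistribution (fun (ε : Ioi (0 : ℝ)) (ω : M) =>
      toPath fun t => a ε * ∫ s in (0 : ℝ)..(t / ε), g (φ s ω)) zeroPlus
      (fun ω' => toPath fun t => (∫ ω, g ω ∂ν) * Z ω' t) (fun _ => P) ℙ :=
  tendstoInDistribution_path_of_restrict (h g hg)

theorem tendsto_eval (h : FunctionalLLN φ ν P a Z ℙ) (hφ : IsMeasurableFlow φ)
    (hZ : ∀ ω', ContinuousOn (Z ω') (Ici 0)) {g : M → ℝ} (hg : Integrable g ν)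
    (hgm : Measurable g) {D : ℝ} (hD : ∀ ω, ‖g ω‖ ≤ D) (T : ℝ≥0) :
    TendstoInDistribution (fun (ε : Ioi (0 : ℝ)) (ω : M) =>
      a ε / ε * ∫ s in (0 : ℝ)..T, g (scaledFlow φ ε s ω)) zeroPlus
      (fun ω' => (∫ ω, g ω ∂ν) * Z ω' T) (fun _ => P) ℙ := by
  refine ((h.tendsto_path hg).continuous_comp (continuous_eval_const T)).congr
    (fun ε => ae_of_all _ fun ω => ?_) (ae_of_all _ fun ω' => ?_)
  · exact toPath_integral_flow_apply hφ ε.2 hgm hD _ _ _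
  · exact toPath_apply (continuousOn_const.mul (hZ ω')) T

/-- The occupation integrals of a function of integral zero tend to zero in probability. -/
theorem tendsto_measure_of_integral_eq_zero (h : FunctionalLLN φ ν P a Z ℙ)
    (hφ : IsMeasurableFlow φ) {g : M → ℝ} (hg : Integrable g ν) (hgm : Measurable g) {D : ℝ}
    (hD : ∀ ω, ‖g ω‖ ≤ D) (h0 : ∫ ω, g ω ∂ν = 0) (T : ℝ≥0) {η : ℝ} (hη : 0 < η) :
    Tendsto (fun ε : Ioi (0 : ℝ) => P {ω | ∃ t : ℝ≥0, t ≤ T ∧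
      η ≤ ‖a ε / ε * ∫ s in (0 : ℝ)..t, g (scaledFlow φ ε s ω)‖}) zeroPlus (𝓝 0) := by
  have h1 := h g hg T
  have e : (fun ω' => restrictPath T (toPath fun t => (∫ ω, g ω ∂ν) * Z ω' t)) =
      fun _ : Ω => (0 : C(Icc (0 : ℝ≥0) T, ℝ)) := by
    ext ω' t
    simp only [h0, zero_mul, restrictPath, ContinuousMap.restrict_apply]
    exact toPath_apply continuousOn_const _
  rw [e] at h1
  refine (tendsto_measure_of_tendstoInDistribution_zero h1 hη).congr fun ε => ?_
  congr 1
  ext ω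
  simp only [mem_ofPred_eq, toPath_integral_flow_apply hφ ε.2 hgm hD]

/-- For a bounded integrable vector-valued function `F`, the occupation integrals of `F` are
asymptotically proportional to those of a function `g` of integral `1`. -/
theorem tendsto_measure_norm_sub {d : ℕ} (h : FunctionalLLN φ ν P a Z ℙ)
    (hφ : IsMeasurableFlow φ) {g : M → ℝ} (hg : Integrable g ν) (hgm : Measurable g) {D : ℝ}
    (hD : ∀ ω, ‖g ω‖ ≤ D) (h1 : ∫ ω, g ω ∂ν = 1) {F : M → EuclideanSpace ℝ (Fin d)}
    (hF : Integrable F ν) (hFm : Measurable F) {C : ℝ} (hC : ∀ ω, ‖F ω‖ ≤ C)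
    (T : ℝ≥0) {η : ℝ} (hη : 0 < η) :
    Tendsto (fun ε : Ioi (0 : ℝ) => P {ω | ∃ t : ℝ≥0, t ≤ T ∧
      η ≤ ‖(a ε / ε) • (∫ s in (0 : ℝ)..t, F (scaledFlow φ ε s ω)) -
        (a ε / ε * ∫ s in (0 : ℝ)..t, g (scaledFlow φ ε s ω)) • ∫ ω, F ω ∂ν‖})
      zeroPlus (𝓝 0) := by
  let c := ∫ ω, F ω ∂ν
  let G : Fin d → M → ℝ := fun j ω => F ω j - c j * g ω
  have hprj : ∀ j, Integrable (fun ω => F ω j) ν := fun j =>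
    (EuclideanSpace.proj (𝕜 := ℝ) j).integrable_comp hF
  have hcj : ∀ j, ∫ ω, F ω j ∂ν = c j := fun j =>
    (EuclideanSpace.proj (𝕜 := ℝ) j).integral_comp_comm hF
  have hFj : ∀ j, Measurable fun ω => F ω j := fun j =>
    (EuclideanSpace.proj (𝕜 := ℝ) j).continuous.measurable.comp hFm
  have hle : ∀ (y : EuclideanSpace ℝ (Fin d)) j, ‖y j‖ ≤ ‖y‖ := fun y j => PiLp.norm_apply_le y j
  have hG : ∀ j, Tendsto (fun ε : Ioi (0 : ℝ) => P {ω | ∃ t : ℝ≥0, t ≤ T ∧ η / (d + 1) ≤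
      ‖a ε / ε * ∫ s in (0 : ℝ)..t, G j (scaledFlow φ ε s ω)‖}) zeroPlus (𝓝 0) := fun j => by
    refine h.tendsto_measure_of_integral_eq_zero hφ (D := C + ‖c j‖ * D)
      ((hprj j).sub (hg.const_mul _)) ((hFj j).sub (measurable_const.mul hgm)) (fun ω => ?_) ?_ T
      (by positivity)
    · refine (norm_sub_le _ _).trans (add_le_add ((hle _ _).trans (hC ω)) ?_)
      rw [norm_mul]
      exact mul_le_mul_of_nonneg_left (hD ω) (norm_nonneg _)
    · change ∫ ω, (F ω j - c j * g ω) ∂ν = 0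
      rw [integral_sub (hprj j) (hg.const_mul _), integral_const_mul, h1, hcj, mul_one, sub_self]
  have hsum : Tendsto (fun ε : Ioi (0 : ℝ) => ∑ j, P {ω | ∃ t : ℝ≥0, t ≤ T ∧ η / (d + 1) ≤
      ‖a ε / ε * ∫ s in (0 : ℝ)..t, G j (scaledFlow φ ε s ω)‖}) zeroPlus (𝓝 0) := by
    simpa using tendsto_finsetSum Finset.univ fun j _ => hG j
  refine tendsto_of_tendsto_of_tendsto_of_le_of_le tendsto_const_nhds hsum (fun _ => zero_le)
    fun ε => ?_
  refine (measure_mono fun ω hω => ?_).trans (measure_iUnion_fintype_le P fun j => {ω |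
    ∃ t : ℝ≥0, t ≤ T ∧ η / (d + 1) ≤ ‖a ε / ε * ∫ s in (0 : ℝ)..t, G j (scaledFlow φ ε s ω)‖})
  obtain ⟨t, ht, hη'⟩ := hω
  by_contra hcon
  simp only [mem_iUnion, mem_ofPred_eq, not_exists, not_and, not_le] at hcon
  set y := (a ε / ε) • (∫ s in (0 : ℝ)..t, F (scaledFlow φ ε s ω)) -
        (a ε / ε * ∫ s in (0 : ℝ)..t, g (scaledFlow φ ε s ω)) • ∫ ω, F ω ∂ν with hy
  have hFi := intervalIntegrable_scaledFlow hφ ε.2 hFm hC ω 0 t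
  have hgi := intervalIntegrable_scaledFlow hφ ε.2 hgm hD ω 0 t
  have hyj : ∀ j, ‖y j‖ ≤ η / (d + 1) := fun j => by
    have e1 : (∫ s in (0 : ℝ)..t, F (scaledFlow φ ε s ω)) j =
        ∫ s in (0 : ℝ)..t, F (scaledFlow φ ε s ω) j :=
      ((EuclideanSpace.proj (𝕜 := ℝ) j).intervalIntegral_comp_comm hFi).symm
    have hFji : IntervalIntegrable (fun s => F (scaledFlow φ ε s ω) j) volume 0 t :=
      intervalIntegrable_scaledFlow hφ ε.2 (hFj j) (fun ω => (hle _ j).trans (hC ω)) ω 0 t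
    have e2 : y j = a ε / ε * ∫ s in (0 : ℝ)..t, G j (scaledFlow φ ε s ω) := by
      simp only [hy, PiLp.sub_apply, PiLp.smul_apply, smul_eq_mul, e1, G]
      rw [intervalIntegral.integral_sub hFji (hgi.const_mul _),
        intervalIntegral.integral_const_mul]
      simp only [c]
      ring
    rw [e2]
    exact (hcon j t ht).le
  have hyn : ‖y‖ ≤ ∑ j, ‖y j‖ := by
    conv_lhs => rw [← (EuclideanSpace.basisFun (Fin d) ℝ).sum_repr y]
    refine (norm_sum_le _ _).trans (Finset.sum_le_sum fun j _ => ?_)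
    rw [norm_smul, (EuclideanSpace.basisFun (Fin d) ℝ).norm_eq_one, mul_one]
    rfl
  have : ∑ j, ‖y j‖ ≤ d * (η / (d + 1)) := by
    refine (Finset.sum_le_sum fun j _ => hyj j).trans (le_of_eq ?_)
    simp
  have h3 : d * (η / (d + 1)) < η := by
    rw [mul_div_assoc', div_lt_iff₀ (by positivity)]
    nlinarith
  linarith

/-- If `a_ε/ε` does not tend to infinity, then `Z_T ≤ 0` almost surely. Indeed the occupation
integral of the indicator of `A` is at most `T a_ε/ε`, so that `ν(A) Z_T` is bounded uniformly
in `A`, while `ν` is infinite. -/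
theorem ae_nonpos_of_not_tendsto [SigmaFinite ν] (h : FunctionalLLN φ ν P a Z ℙ)
    (hν : ν univ = ⊤) (hφ : IsMeasurableFlow φ) (ha : ∀ ε, 0 < ε → 0 < a ε)
    (hZ : ∀ ω', ContinuousOn (Z ω') (Ici 0))
    (hb : ¬ Tendsto (fun ε : Ioi (0 : ℝ) => a ε / ε) zeroPlus atTop) (T : ℝ≥0) :
    ∀ᵐ ω' ∂ℙ, Z ω' T ≤ 0 := by
  obtain ⟨B, hB⟩ : ∃ B : ℝ, ∃ᶠ ε : Ioi (0 : ℝ) in zeroPlus, a ε / ε < B := by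
    simpa only [tendsto_atTop, not_forall, not_eventually, not_le] using hb
  -- apply the portmanteau inequality to the indicator of a set of measure larger than `n`
  have key : ∀ n : ℕ, ∀ᵐ ω' ∂ℙ, 0 < Z ω' T → n * Z ω' T ≤ B * T := by
    intro n
    obtain ⟨A, hA, hn, hfin⟩ := exists_measurableSet_lt_measure hν n
    let g : M → ℝ := A.indicator fun _ => 1
    have hg0 : ∀ ω, 0 ≤ g ω := fun ω => indicator_nonneg (fun _ _ => zero_le_one) ω
    have hg1 : ∀ ω, g ω ≤ 1 := fun ω => indicator_le_self' (fun _ _ => zero_le_one) ω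
    have hgm : Measurable g := measurable_const.indicator hA
    have hgn : ∀ ω, ‖g ω‖ ≤ 1 := fun ω => by rw [Real.norm_of_nonneg (hg0 ω)]; exact hg1 ω
    have hgi : Integrable g ν := (integrable_indicator_iff hA).2 (integrableOn_const hfin.ne)
    have hint : ∫ ω, g ω ∂ν = ν.real A := by
      simp only [g]; rw [integral_indicator hA]; simp
    have hlim := le_of_tendstoInDistribution_of_isOpen
      (h.tendsto_eval hφ hZ hgi hgm hgn T) (isOpen_Ioi (a := B * T))
    have hzero : (zeroPlus.liminf fun ε : Ioi (0 : ℝ) => P ((fun ω => a ε / ε *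
        ∫ s in (0 : ℝ)..T, g (scaledFlow φ ε s ω)) ⁻¹' Ioi (B * T))) ≤ 0 := by
      refine liminf_le_of_frequently_le (hB.mono fun ε hε => le_of_eq ?_)
      rw [show (fun ω => a ε / ε * ∫ s in (0 : ℝ)..T, g (scaledFlow φ ε s ω)) ⁻¹' Ioi (B * T) = ∅
        from ?_, measure_empty]
      refine eq_empty_of_forall_notMem fun ω hω => ?_
      have h1 : ∫ s in (0 : ℝ)..T, g (scaledFlow φ ε s ω) ≤ T := by
        have := intervalIntegral.integral_mono_on T.coe_nonneg
          (intervalIntegrable_scaledFlow hφ ε.2 hgm hgn ω 0 T)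
          (intervalIntegrable_const (c := (1 : ℝ))) fun s _ => hg1 _
        simpa using this
      have h2 : 0 < a ε / ε := div_pos (ha _ ε.2) ε.2
      have h3 : a ε / ε * ∫ s in (0 : ℝ)..T, g (scaledFlow φ ε s ω) ≤ a ε / ε * T := by gcongr
      have h4 : a ε / ε * T ≤ B * T := by gcongr
      exact absurd hω (not_lt.2 (h3.trans h4))
    have hnull : ℙ {ω' | B * T < ν.real A * Z ω' T} = 0 := by
      have := hlim.trans hzero
      rw [hint] at this
      exact le_antisymm this zero_le
    have : ∀ᵐ ω' ∂ℙ, ¬ B * T < ν.real A * Z ω' T := measure_eq_zero_iff_ae_notMem.1 hnull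
    filter_upwards [this] with ω' hω' hpos
    rw [not_lt] at hω'
    nlinarith
  filter_upwards [ae_all_iff.2 key] with ω' hω'
  by_contra hcon
  rw [not_le] at hcon
  obtain ⟨n, hn⟩ := exists_nat_gt (B * T / Z ω' T)
  rw [div_lt_iff₀ hcon] at hn
  exact absurd (hω' n hcon) (not_le.2 hn)

/-- The square of an occupation integral, divided by `a_ε/ε`, is negligible: either `a_ε/ε` tends to
infinity, or the occupation integral itself tends to zero in probability. -/
theorem tendsto_measure_sq_div [SigmaFinite ν] (h : FunctionalLLN φ ν P a Z ℙ)
    (hν : ν univ = ⊤) (hφ : IsMeasurableFlow φ) (ha : ∀ ε, 0 < ε → 0 < a ε)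
    (hZ : ∀ ω', ContinuousOn (Z ω') (Ici 0)) {G : M → ℝ} (hG : Integrable G ν)
    (hGm : Measurable G) (hG0 : ∀ ω, 0 ≤ G ω) {D : ℝ} (hD : ∀ ω, G ω ≤ D) (T : ℝ≥0) {η : ℝ}
    (hη : 0 < η) :
    Tendsto (fun ε : Ioi (0 : ℝ) => P {ω | η ≤
      (a ε / ε * ∫ s in (0 : ℝ)..T, G (scaledFlow φ ε s ω)) ^ 2 / (a ε / ε)})
      zeroPlus (𝓝 0) := by
  have hGn : ∀ ω, ‖G ω‖ ≤ D := fun ω => by rw [Real.norm_of_nonneg (hG0 ω)]; exact hD ω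
  have hlaw := h.tendsto_eval hφ hZ hG hGm hGn T
  have hb0 : ∀ ε : Ioi (0 : ℝ), 0 < a ε / ε := fun ε => div_pos (ha _ ε.2) ε.2
  have hI0 : ∀ (ε : Ioi (0 : ℝ)) ω, 0 ≤ ∫ s in (0 : ℝ)..T, G (scaledFlow φ ε s ω) := fun ε ω =>
    intervalIntegral.integral_nonneg T.coe_nonneg fun s _ => hG0 _
  refine ENNReal.tendsto_nhds_zero.2 fun δ hδ => ?_
  by_cases hb : Tendsto (fun ε : Ioi (0 : ℝ) => a ε / ε) zeroPlus atTop
  · obtain ⟨K, hK0, hK⟩ := exists_measure_le_of_tendstoInDistribution hlaw hδ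
    filter_upwards [hK, hb.eventually_gt_atTop (K ^ 2 / η)] with ε hε1 hε2
    refine (measure_mono fun ω hω => ?_).trans hε1
    by_contra hcon
    simp only [mem_ofPred_eq, not_le] at hω hcon
    rw [le_div_iff₀ (hb0 ε)] at hω
    rw [div_lt_iff₀ hη] at hε2
    have : (a ε / ε * ∫ s in (0 : ℝ)..T, G (scaledFlow φ ε s ω)) ^ 2 ≤ K ^ 2 :=
      pow_le_pow_left₀ (mul_nonneg (hb0 ε).le (hI0 ε ω)) hcon.le 2
    linarith
  · have hZ0 := h.ae_nonpos_of_not_tendsto hν hφ ha hZ hb T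
    rcases isEmpty_or_nonempty M with hM | ⟨⟨ω₀⟩⟩
    · refine Eventually.of_forall fun ε => ?_
      rw [show {ω | η ≤ (a ε / ε * ∫ s in (0 : ℝ)..T, G (scaledFlow φ ε s ω)) ^ 2 / (a ε / ε)} = ∅
        from Subsingleton.elim _ _]
      simp
    have hD0 : 0 ≤ D := (hG0 ω₀).trans (hD ω₀)
    have hpos : 0 < T * D + 1 := by positivity
    have hlim := limsup_le_of_tendstoInDistribution_of_isClosed hlaw
      (isClosed_Ici (a := η / (T * D + 1)))
    have hnull : ℙ ((fun ω' => (∫ ω, G ω ∂ν) * Z ω' T) ⁻¹' Ici (η / (T * D + 1))) = 0 := by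
      refine measure_eq_zero_iff_ae_notMem.2 ?_
      filter_upwards [hZ0] with ω' hω' hmem
      have h1 : (∫ ω, G ω ∂ν) * Z ω' T ≤ 0 :=
        mul_nonpos_of_nonneg_of_nonpos (integral_nonneg hG0) hω'
      have h2 : 0 < η / (T * D + 1) := by positivity
      exact absurd (h2.trans_le hmem) (not_lt.2 h1)
    rw [hnull] at hlim
    filter_upwards [eventually_lt_of_limsup_lt (hlim.trans_lt hδ)] with ε hε
    refine (measure_mono fun ω hω => ?_).trans hε.le
    simp only [mem_ofPred_eq, mem_preimage, mem_Ici] at hω ⊢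
    have hI1 : ∫ s in (0 : ℝ)..T, G (scaledFlow φ ε s ω) ≤ T * D := by
      have := intervalIntegral.integral_mono_on T.coe_nonneg
        (intervalIntegrable_scaledFlow hφ ε.2 hGm hGn ω 0 T)
        (intervalIntegrable_const (c := D)) fun s _ => hD _
      simpa using this
    have e : (a ε / ε * ∫ s in (0 : ℝ)..T, G (scaledFlow φ ε s ω)) ^ 2 / (a ε / ε) =
        (a ε / ε * ∫ s in (0 : ℝ)..T, G (scaledFlow φ ε s ω)) *
          ∫ s in (0 : ℝ)..T, G (scaledFlow φ ε s ω) := by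
      have := (hb0 ε).ne'
      rw [div_eq_iff this]
      ring
    rw [e] at hω
    rw [div_le_iff₀ hpos]
    refine hω.trans (mul_le_mul_of_nonneg_left (by linarith) (mul_nonneg (hb0 ε).le (hI0 ε ω)))

end FunctionalLLN

/-! ### The rescaled error as the solution of a linear equation -/

section Error

variable {E : Type*} [NormedAddCommGroup E] [NormedSpace ℝ E] [SecondCountableTopology E]
  [MeasurableSpace E] [BorelSpace E] {k : ℝ → E → E} {fbar : E → E} {ℓ G : ℝ → ℝ}
  {C D : ℝ} {x : E} {W X : ℝ → E}

/-- The driving term of the linear equation satisfied by the rescaled error `b (X - W)` is close to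
a Riemann–Stieltjes sum with respect to `z`, if the integrals of `k` along the frozen values of `W`
at the grid points are close to multiples of `z`. -/
theorem norm_driving_sub_riemannStieltjesSum_le (hk : Measurable (Function.uncurry k))
    (hkC : ∀ s y, ‖k s y‖ ≤ C) (hℓ0 : ∀ s, 0 ≤ ℓ s)
    (hℓC : ∀ s, ℓ s ≤ C) (hklip : ∀ s y z, ‖k s y - k s z‖ ≤ ℓ s * ‖y - z‖)
    (hfbar : TwiceDiffBounded fbar C) (hW : IsSolution (fun _ y => fbar y) x W)
    (hX : IsSolution (fun s y => k s y + fbar y) x X)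
    (hG : Measurable G) (hG0 : ∀ s, 0 ≤ G s) (hGD : ∀ s, G s ≤ D) (hℓG : ∀ s, ℓ s ≤ G s)
    {T : ℝ≥0} (hkG : ∀ s : ℝ, 0 ≤ s → s ≤ T → ‖k s (W s)‖ ≤ G s) {b : ℝ} (hb : 0 < b)
    {n : ℕ} (hn : 0 < n) (hTn : T ≤ n) {z : C(ℝ≥0, ℝ)} {q : ℕ → E} {θ : ℝ}
    (hθ : ∀ i < n * n, ∀ t : ℝ≥0, t ≤ T →
      ‖b • (∫ s in (0 : ℝ)..t, k s (W ((i : ℝ) / n))) - z t • q i‖ ≤ θ)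
    {t : ℝ≥0} (ht : t ≤ T) :
    ‖b • (X t - W t) - (∫ s in (0 : ℝ)..t, fderiv ℝ fbar (W s) (b • (X s - W s))) -
      riemannStieltjesSum n q z t‖ ≤
      (Real.exp (2 * C * T) + C * T * Real.exp (2 * C * T) ^ 2) *
        ((b * ∫ s in (0 : ℝ)..T, G s) ^ 2 / b) + C / n * (b * ∫ s in (0 : ℝ)..T, G s) +
        (n * n : ℕ) * (2 * θ) := by
  have hC0 : 0 ≤ C := (norm_nonneg _).trans (hfbar.bound x)
  have htT : (t : ℝ) ≤ T := by exact_mod_cast ht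
  have htn : (t : ℝ) ≤ n := htT.trans (by exact_mod_cast hTn)
  have ht0 := t.coe_nonneg
  have hfm : Measurable (Function.uncurry fun (_ : ℝ) y => fbar y) :=
    hfbar.differentiable.continuous.measurable.comp measurable_snd
  have hGi : ∀ a b, IntervalIntegrable G volume a b := fun a b => by
    rw [intervalIntegrable_iff]
    exact IntegrableOn.of_bound (by simp) hG.aestronglyMeasurable D
      (ae_of_all _ fun s => by rw [Real.norm_of_nonneg (hG0 s)]; exact hGD s)
  have hki : ∀ y a b, IntervalIntegrable (fun s => k s y) volume a b := fun y a b => by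
    rw [intervalIntegrable_iff]
    exact IntegrableOn.of_bound (by simp) (hk.comp
      (by fun_prop : Measurable fun s : ℝ => (s, y))).aestronglyMeasurable C
      (ae_of_all _ fun s => hkC s y)
  have hGt : ∫ s in (0 : ℝ)..t, G s ≤ ∫ s in (0 : ℝ)..T, G s :=
    intervalIntegral.integral_mono_interval le_rfl ht0 htT (ae_of_all _ hG0) (hGi _ _)
  have h1 := norm_remainder_le_of_perturbed hk hkC hℓ0 hℓC hklip hfbar hW hX hG hG0 hGD hℓG hkG
    ht0 htT
  have h2 : ‖(∫ s in (0 : ℝ)..t, k s (W s)) - ∑ i ∈ Finset.range (n * n),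
      ∫ s in (gridPoint n t i)..(gridPoint n t (i + 1)), k s (W ((i : ℝ) / n))‖ ≤
      C / n * ∫ s in (0 : ℝ)..T, G s := by
    refine (norm_integral_sub_sum_grid_le (ρ := fun s => C / n * G s) hn ht0 htn
      (hW.intervalIntegrable hk hkC ht0) (fun i => hki _ _ _) ((hGi _ _).const_mul _)
      fun i s hs1 hs2 hst => ?_).trans ?_
    · refine (hklip _ _ _).trans ?_
      rw [mul_comm]
      exact mul_le_mul (norm_sub_le_of_gridPoint hC0
        (fun r s hr hrs => hW.norm_sub_le hfm (fun s y => hfbar.bound y) hr hrs) hs1 hs2)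
        (hℓG s) (hℓ0 s) (by positivity)
    · rw [intervalIntegral.integral_const_mul]
      gcongr
  have h3 : ‖b • (∑ i ∈ Finset.range (n * n),
      ∫ s in (gridPoint n t i)..(gridPoint n t (i + 1)), k s (W ((i : ℝ) / n))) -
      riemannStieltjesSum n q z t‖ ≤ (n * n : ℕ) * (2 * θ) := by
    rw [riemannStieltjesSum_apply, Finset.smul_sum, ← Finset.sum_sub_distrib]
    refine (norm_sum_le _ _).trans ((Finset.sum_le_sum fun i hi => ?_).trans
      (b := ∑ i ∈ Finset.range (n * n), 2 * θ) (by simp))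
    have hp : ∀ j, ‖b • (∫ s in (0 : ℝ)..(gridPoint n t j), k s (W ((i : ℝ) / n))) -
        z (gridPoint n t j).toNNReal • q i‖ ≤ θ := fun j => by
      have hj0 := gridPoint_nonneg n ht0 j
      have := hθ i (Finset.mem_range.1 hi) (gridPoint n t j).toNNReal
        (Real.toNNReal_le_iff_le_coe.2 ((gridPoint_le _ _ _).trans htT))
      rwa [Real.coe_toNNReal _ hj0] at this
    rw [← intervalIntegral.integral_interval_sub_left (hki _ 0 _) (hki _ 0 _)]
    have e : b • ((∫ s in (0 : ℝ)..(gridPoint n t (i + 1)), k s (W ((i : ℝ) / n))) -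
        ∫ s in (0 : ℝ)..(gridPoint n t i), k s (W ((i : ℝ) / n))) -
        (z (gridPoint n t (i + 1)).toNNReal - z (gridPoint n t i).toNNReal) • q i =
        (b • (∫ s in (0 : ℝ)..(gridPoint n t (i + 1)), k s (W ((i : ℝ) / n))) -
          z (gridPoint n t (i + 1)).toNNReal • q i) -
        (b • (∫ s in (0 : ℝ)..(gridPoint n t i), k s (W ((i : ℝ) / n))) -
          z (gridPoint n t i).toNNReal • q i) := by
      rw [smul_sub, sub_smul]; abel
    rw [e, two_mul]
    exact (norm_sub_le _ _).trans (add_le_add (hp _) (hp _))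
  set S := ∫ s in (0 : ℝ)..T, G s
  set c := Real.exp (2 * C * T) + C * T * Real.exp (2 * C * T) ^ 2
  set I1 := ∫ s in (0 : ℝ)..t, fderiv ℝ fbar (W s) (X s - W s)
  set I2 := ∫ s in (0 : ℝ)..t, k s (W s)
  set I3 := ∑ i ∈ Finset.range (n * n),
      ∫ s in (gridPoint n t i)..(gridPoint n t (i + 1)), k s (W ((i : ℝ) / n))
  have e1 : ∫ s in (0 : ℝ)..t, fderiv ℝ fbar (W s) (b • (X s - W s)) = b • I1 := by
    simp only [map_smul]
    exact intervalIntegral.integral_smul _ _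
  have e : b • (X t - W t) - b • I1 - riemannStieltjesSum n q z t =
      b • (X t - W t - I1 - I2) + b • (I2 - I3) + (b • I3 - riemannStieltjesSum n q z t) := by
    simp only [smul_sub]; abel
  rw [e1, e]
  refine norm_add₃_le.trans (add_le_add (add_le_add ?_ ?_) h3)
  · rw [norm_smul, Real.norm_of_nonneg hb.le]
    refine (mul_le_mul_of_nonneg_left h1 hb.le).trans (le_of_eq ?_)
    field_simp
  · rw [norm_smul, Real.norm_of_nonneg hb.le]
    refine (mul_le_mul_of_nonneg_left h2 hb.le).trans (le_of_eq ?_)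
    ring

end Error

theorem isSolution_scaledFlow {M E : Type*} [NormedAddCommGroup E] [NormedSpace ℝ E]
    {φ : ℝ → M → M} {f : E → M → E} {fbar : E → E} {ε : ℝ} {ω : M} {x : E} {X : ℝ → E}
    (hX : IsSolution (fun s y => f y (φ (s / ε) ω) + fbar y) x X) :
    IsSolution (fun s y => f y (scaledFlow φ ε s ω) + fbar y) x X :=
  hX.congr fun s hs => by simp only [scaledFlow, max_eq_left hs]

namespace FunctionalLLN

variable {M Ω : Type*} [MeasurableSpace M] [MeasurableSpace Ω] {φ : ℝ → M → M}
  {ν P : Measure M} [IsProbabilityMeasure P] {a : ℝ → ℝ} {Z : Ω → ℝ → ℝ} {ℙ : Measure Ω}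
  [IsProbabilityMeasure ℙ] {d : ℕ}

set_option maxHeartbeats 1000000 in
/-- The driving term of the linear equation satisfied by the rescaled error is close in probability
to a Riemann–Stieltjes sum with respect to an occupation integral, for a fine grid. -/
theorem eventually_measure_le [SigmaFinite ν] (h : FunctionalLLN φ ν P a Z ℙ)
    (hν : ν univ = ⊤) (hφ : IsMeasurableFlow φ) (ha : ∀ ε, 0 < ε → 0 < a ε)
    (hZ : ∀ ω', ContinuousOn (Z ω') (Ici 0)) {g : M → ℝ} (hg : Integrable g ν)
    (hgm : Measurable g) {Dg : ℝ} (hDg : ∀ ω, ‖g ω‖ ≤ Dg) (h1 : ∫ ω, g ω ∂ν = 1)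
    {f : EuclideanSpace ℝ (Fin d) → M → EuclideanSpace ℝ (Fin d)}
    {fbar : EuclideanSpace ℝ (Fin d) → EuclideanSpace ℝ (Fin d)}
    (hf : Measurable (Function.uncurry f)) {C : ℝ} (hC0 : 0 ≤ C)
    (hf2 : ∀ ω, TwiceDiffBounded (fun y => f y ω) C) (hfbar2 : TwiceDiffBounded fbar C)
    (hfint : ∀ y, Integrable (f y) ν) (hLip : Integrable (fun ω => lipConst fun y => f y ω) ν)
    {x : EuclideanSpace ℝ (Fin d)} {W : ℝ → EuclideanSpace ℝ (Fin d)}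
    (hW : IsSolution (fun _ y => fbar y) x W) {X : ℝ → M → ℝ → EuclideanSpace ℝ (Fin d)}
    (hX : ∀ ε, 0 < ε → ∀ ω, IsSolution (fun s y => f y (φ (s / ε) ω) + fbar y) x (X ε ω))
    (T : ℝ≥0) {η : ℝ} (hη : 0 < η) {δ : ℝ≥0∞} (hδ : 0 < δ) :
    ∀ᶠ n : ℕ in atTop, ∀ᶠ ε : Ioi (0 : ℝ) in zeroPlus, P {ω | ∃ t : ℝ≥0, t ≤ T ∧ η ≤
      ‖(a ε / ε) • (X ε ω t - W t) -
        (∫ s in (0 : ℝ)..t, fderiv ℝ fbar (W s) ((a ε / ε) • (X ε ω s - W s))) -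
        riemannStieltjesSum n (fun i => ∫ ω, f (W ((i : ℝ) / n)) ω ∂ν)
          (toPath fun t => a ε * ∫ s in (0 : ℝ)..(t / ε), g (φ s ω)) t‖} ≤ δ := by
  let L : M → ℝ := fun ω => lipConst fun y => f y ω
  have hlip : ∀ ω y z, ‖f y ω - f z ω‖ ≤ C * ‖y - z‖ := fun ω => (hf2 ω).norm_sub_le
  have hL0 : ∀ ω, 0 ≤ L ω := fun ω => lipConst_nonneg _
  have hLC : ∀ ω, L ω ≤ C := fun ω => lipConst_le hC0 (hlip ω)
  have hLlip : ∀ ω y z, ‖f y ω - f z ω‖ ≤ L ω * ‖y - z‖ := fun ω =>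
    norm_sub_le_lipConst_mul hC0 (hlip ω)
  have hfy : ∀ y, Measurable (f y) := fun y => hf.comp measurable_prodMk_left
  have hLm : Measurable L := measurable_lipConst hfy hC0 hlip
  have hfm : Measurable (Function.uncurry fun (_ : ℝ) y => fbar y) :=
    hfbar2.differentiable.continuous.measurable.comp measurable_snd
  have hT0 := T.coe_nonneg
  -- an integrable majorant of `f` along `W` on `[0,T]`, and of the Lipschitz constants
  let G : M → ℝ := fun ω => ‖f x ω‖ + (C * T + 1) * L ω
  have hGm : Measurable G := (hfy x).norm.add (measurable_const.mul hLm)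
  have hGi : Integrable G ν := (hfint x).norm.add (hLip.const_mul _)
  have hG0 : ∀ ω, 0 ≤ G ω := fun ω =>
    add_nonneg (norm_nonneg _) (mul_nonneg (by positivity) (hL0 ω))
  have hGD : ∀ ω, G ω ≤ C + (C * T + 1) * C := fun ω =>
    add_le_add ((hf2 ω).bound x) (mul_le_mul_of_nonneg_left (hLC ω) (by positivity))
  have hLG : ∀ ω, L ω ≤ G ω := fun ω => by
    have h1 : 0 ≤ C * T * L ω := mul_nonneg (by positivity) (hL0 ω)
    have h2 := norm_nonneg (f x ω)
    simp only [G]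
    linarith
  have hfG : ∀ ω (s : ℝ), 0 ≤ s → s ≤ T → ‖f (W s) ω‖ ≤ G ω := fun ω s hs hsT => by
    have e : f (W s) ω = f x ω + (f (W s) ω - f x ω) := by abel
    have h1 : ‖W s - x‖ ≤ C * T := by
      have := hW.norm_sub_le hfm (fun s y => hfbar2.bound y) le_rfl hs
      rw [hW.2 0 le_rfl, intervalIntegral.integral_same, add_zero, sub_zero] at this
      exact this.trans (mul_le_mul_of_nonneg_left hsT hC0)
    have h2 := (hLlip ω (W s) x).trans (mul_le_mul_of_nonneg_left h1 (hL0 ω))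
    rw [e]
    refine (norm_add_le _ _).trans (add_le_add le_rfl (h2.trans ?_))
    have := hL0 ω
    linarith
  have hb0 : ∀ ε : Ioi (0 : ℝ), 0 < a ε / ε := fun ε => div_pos (ha _ ε.2) ε.2
  set c := Real.exp (2 * C * T) + C * T * Real.exp (2 * C * T) ^ 2
  have hc0 : 0 < c := by positivity
  have hδ3 : 0 < δ / 3 := ENNReal.div_pos hδ.ne' (by simp)
  -- the quadratic remainder, the discretisation error and the error at the grid points
  have hS2 := h.tendsto_measure_sq_div hν hφ ha hZ hGi hGm hG0 hGD T (η := η / 3 / c)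
    (by positivity)
  obtain ⟨K, hK0, hK⟩ := exists_measure_le_of_tendstoInDistribution
    (h.tendsto_eval hφ hZ hGi hGm
      (fun ω => by rw [Real.norm_of_nonneg (hG0 ω)]; exact hGD ω) T) hδ3
  have hnlim : Tendsto (fun n : ℕ => C / n * K) atTop (𝓝 0) := by
    simpa using (tendsto_const_div_atTop_nhds_zero_nat C).mul_const K
  filter_upwards [hnlim.eventually_lt_const (by positivity : 0 < η / 3),
    eventually_ge_atTop ⌈T⌉₊, eventually_gt_atTop 0] with n hn1 hn2 hn0
  have hTn : T ≤ n := Nat.ceil_le.1 hn2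
  -- with this choice, the `n²` errors at the grid points, counted twice, add up to less
  -- than `η / 3`
  set θ := η / 3 / (2 * (n * n : ℕ) + 1) / 2 with hθdef
  have hθ0 : 0 < θ := by positivity
  have hgrid : Tendsto (fun ε : Ioi (0 : ℝ) => ∑ i ∈ Finset.range (n * n), P {ω | ∃ t : ℝ≥0,
      t ≤ T ∧ θ ≤ ‖(a ε / ε) • (∫ s in (0 : ℝ)..t, f (W ((i : ℝ) / n)) (scaledFlow φ ε s ω)) -
        (a ε / ε * ∫ s in (0 : ℝ)..t, g (scaledFlow φ ε s ω)) •
          ∫ ω, f (W ((i : ℝ) / n)) ω ∂ν‖}) zeroPlus (𝓝 0) := by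
    simpa using tendsto_finsetSum (Finset.range (n * n)) fun i _ =>
      h.tendsto_measure_norm_sub hφ hg hgm hDg h1 (hfint (W ((i : ℝ) / n)))
        (hfy _) (fun ω => (hf2 ω).bound _) T hθ0
  filter_upwards [hK, hS2.eventually_lt_const hδ3, hgrid.eventually_lt_const hδ3]
    with ε hε1 hε2 hε3
  have e3 : δ = δ / 3 + δ / 3 + δ / 3 := (ENNReal.add_thirds δ).symm
  rw [e3]
  refine (measure_mono ?_).trans ((measure_union_le _ _).trans (add_le_add
    ((measure_union_le _ _).trans (add_le_add hε2.le hε1))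
    ((measure_biUnion_finset_le _ _).trans hε3.le)))
  rintro ω ⟨t, ht, hω⟩
  by_contra hcon
  simp only [mem_union, mem_iUnion, mem_ofPred_eq, not_or, not_exists, not_and, not_le,
    Finset.mem_range] at hcon
  obtain ⟨⟨hc1, hc2⟩, hc3⟩ := hcon
  have hψ := measurable_scaledFlow hφ ε.2
  have hψω : Measurable fun s => scaledFlow φ ε s ω :=
    hψ.comp (by fun_prop : Measurable fun s : ℝ => (s, ω))
  have hbound := norm_driving_sub_riemannStieltjesSum_le
    (k := fun s y => f y (scaledFlow φ ε s ω)) (ℓ := fun s => L (scaledFlow φ ε s ω))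
    (G := fun s => G (scaledFlow φ ε s ω)) (C := C) (b := a ε / ε) (n := n) (T := T) (θ := θ)
    (z := toPath fun t => a ε * ∫ s in (0 : ℝ)..(t / ε), g (φ s ω))
    (q := fun i => ∫ ω, f (W ((i : ℝ) / n)) ω ∂ν)
    (hf.comp (measurable_snd.prodMk (hψω.comp measurable_fst)))
    (fun s y => (hf2 _).bound y) (fun s => hL0 _) (fun s => hLC _) (fun s y z => hLlip _ y z)
    hfbar2 hW (isSolution_scaledFlow (hX ε ε.2 ω)) (hGm.comp hψω) (fun s => hG0 _)
    (fun s => hGD _) (fun s => hLG _) (fun s hs hsT => hfG _ s hs hsT) (hb0 ε) hn0 hTn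
    (fun i hi t ht => by
      rw [toPath_integral_flow_apply hφ ε.2 hgm hDg]
      exact (hc3 i hi t ht).le) ht
  have b1 : c * ((a ε / ε * ∫ s in (0 : ℝ)..T, G (scaledFlow φ ε s ω)) ^ 2 / (a ε / ε)) <
      η / 3 := by
    rw [lt_div_iff₀ hc0] at hc1
    linarith
  have b2 : C / n * (a ε / ε * ∫ s in (0 : ℝ)..T, G (scaledFlow φ ε s ω)) < η / 3 :=
    lt_of_le_of_lt (by gcongr) hn1
  have b3 : ((n * n : ℕ) : ℝ) * (2 * θ) < η / 3 := by
    have : 2 * θ = η / 3 / (2 * (n * n : ℕ) + 1) := by rw [hθdef]; ring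
    rw [this, mul_div_assoc', div_lt_iff₀ (by positivity)]
    have : (0 : ℝ) ≤ (n * n : ℕ) := by positivity
    nlinarith
  linarith

end FunctionalLLN

theorem mainTheorem6 {d : ℕ} {M Ω : Type*} [MeasurableSpace M] [MeasurableSpace Ω]
    -- the conservative ergodic flow, preserving an infinite σ-finite measure
    (ν : Measure M) [SigmaFinite ν] (hν : ν univ = ⊤)
    (φ : ℝ → M → M) (hφ : IsMeasurableFlow φ)
    (hφν : ∀ t, 0 ≤ t → MeasurePreserving (φ t) ν ν)
    (hcons : IsConservativeFlow φ ν) (herg : IsErgodicFlow φ ν)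
    -- the continuous increasing process `Z`
    (ℙ : Measure Ω) [IsProbabilityMeasure ℙ] (Z : Ω → ℝ → ℝ)
    (hZmeas : ∀ t, 0 ≤ t → Measurable fun ω' => Z ω' t)
    (hZcont : ∀ ω', ContinuousOn (Z ω') (Ici 0))
    (hZmono : ∀ ω', MonotoneOn (Z ω') (Ici 0))
    -- the functional law of large numbers
    (a : ℝ → ℝ) (ha : ∀ ε, 0 < ε → 0 < a ε)
    (hFLLN : ∀ g : M → ℝ, Integrable g ν → ∀ T : ℝ≥0,
      StrongTendstoInDistribution ν
        (fun (ε : Set.Ioi (0 : ℝ)) (ω : M) => restrictPath T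
          (toPath fun t => a ε * ∫ s in (0 : ℝ)..(t / ε), g (φ s ω)))
        (fun ω' => restrictPath T (toPath fun t => (∫ ω, g ω ∂ν) * Z ω' t)) ℙ)
    -- the vector fields
    (f : EuclideanSpace ℝ (Fin d) → M → EuclideanSpace ℝ (Fin d))
    (fbar : EuclideanSpace ℝ (Fin d) → EuclideanSpace ℝ (Fin d))
    (hf : Measurable (Function.uncurry f))
    (hf2 : ∃ C : ℝ, ∀ ω, TwiceDiffBounded (fun y => f y ω) C)
    (hfbar2 : ∃ C : ℝ, TwiceDiffBounded fbar C)
    (hfint : ∀ y, Integrable (f y) ν)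
    (hLip : Integrable (fun ω => lipConst fun y => f y ω) ν)
    (hLipD : Integrable (fun ω => lipConst (fderiv ℝ fun y => f y ω)) ν)
    -- the averaged and the perturbed solutions
    (x : EuclideanSpace ℝ (Fin d))
    (W : ℝ → EuclideanSpace ℝ (Fin d)) (hW : IsSolution (fun _ y => fbar y) x W)
    (X : ℝ → M → ℝ → EuclideanSpace ℝ (Fin d))
    (hX : ∀ ε, 0 < ε → ∀ ω,
      IsSolution (fun s y => f y (φ (s / ε) ω) + fbar y) x (X ε ω))
    -- the process `V`
    (V : Ω → ℝ → EuclideanSpace ℝ (Fin d))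
    (hV : ∀ ω' t, V ω' t =
      stieltjesIntegral (fun s => ∫ ω, f (W s) ω ∂ν) (Z ω') (hZcont ω') (hZmono ω') t) :
    ∃ Y : Ω → ℝ → EuclideanSpace ℝ (Fin d),
      (∀ ω', ContinuousOn (Y ω') (Ici 0)) ∧
      (∀ ω' t, 0 ≤ t →
        Y ω' t = V ω' t + ∫ s in (0 : ℝ)..t, fderiv ℝ fbar (W s) (Y ω' s)) ∧
      ((∀ s t, 0 ≤ s → 0 ≤ t → Commute (fderiv ℝ fbar (W s)) (fderiv ℝ fbar (W t))) →
        ∀ ω' t, 0 ≤ t →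
          Y ω' t = V ω' t + ∫ s in (0 : ℝ)..t,
            (fderiv ℝ fbar (W s) * NormedSpace.exp (∫ u in s..t, fderiv ℝ fbar (W u)))
              (V ω' s)) ∧
      StrongTendstoInDistribution ν
        (fun (ε : Set.Ioi (0 : ℝ)) (ω : M) => toPath fun t => (a ε / ε) • (X ε ω t - W t))
        (fun ω' => toPath (Y ω')) ℙ := by
  obtain ⟨C₁, hC₁⟩ := hf2
  obtain ⟨C₂, hC₂⟩ := hfbar2
  let C := max C₁ C₂
  have hf' : ∀ ω, TwiceDiffBounded (fun y => f y ω) C := fun ω => (hC₁ ω).mono (le_max_left _ _)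
  have hfbar : TwiceDiffBounded fbar C := hC₂.mono (le_max_right _ _)
  have hC0 : 0 ≤ C := (norm_nonneg _).trans (hfbar.bound x)
  have hfm : Measurable (Function.uncurry fun (_ : ℝ) y => fbar y) :=
    hfbar.differentiable.continuous.measurable.comp measurable_snd
  -- the coefficient of the linear equation, extended to negative times
  let A : ℝ → EuclideanSpace ℝ (Fin d) →L[ℝ] EuclideanSpace ℝ (Fin d) :=
    fun s => fderiv ℝ fbar (W (max s 0))
  have hWc : Continuous fun s => W (max s 0) :=
    hW.1.comp_continuous (continuous_id.max continuous_const) fun s => le_max_right s 0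
  have hA : Continuous A := hfbar.continuous_fderiv.comp hWc
  have hAC : ∀ s, ‖A s‖ ≤ C := fun s => hfbar.bound_fderiv _
  have hAeq : ∀ s, 0 ≤ s → A s = fderiv ℝ fbar (W s) := fun s hs => by
    simp only [A, max_eq_left hs]
  -- the averaged coefficient is Lipschitz along `W`
  let u : ℝ → EuclideanSpace ℝ (Fin d) := fun s => ∫ ω, f (W s) ω ∂ν
  have hlip : ∀ ω y z, ‖f y ω - f z ω‖ ≤ C * ‖y - z‖ := fun ω => (hf' ω).norm_sub_le
  let K := (∫ ω, lipConst (fun y => f y ω) ∂ν) * C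
  have hK0 : 0 ≤ K := mul_nonneg (integral_nonneg fun ω => lipConst_nonneg _) hC0
  have hu : ∀ r s, 0 ≤ r → r ≤ s → ‖u s - u r‖ ≤ K * (s - r) := fun r s hr hrs => by
    simp only [u]
    rw [← integral_sub (hfint _) (hfint _)]
    refine (norm_integral_le_of_norm_le (hLip.mul_const (C * (s - r)))
      (ae_of_all _ fun ω => ?_)).trans (le_of_eq ?_)
    · exact (norm_sub_le_lipConst_mul hC0 (hlip ω) _ _).trans (mul_le_mul_of_nonneg_left
        (hW.norm_sub_le hfm (fun s y => hfbar.bound y) hr hrs) (lipConst_nonneg _))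
    · rw [integral_mul_const, mul_assoc]
  have hVeq : ∀ ω', V ω' = stieltjesIntegral u (Z ω') (hZcont ω') (hZmono ω') := fun ω' =>
    funext fun t => hV ω' t
  have hVc : ∀ ω', ContinuousOn (V ω') (Ici 0) := fun ω' => by
    rw [hVeq]; exact continuousOn_stieltjesIntegral hK0 hu _ _
  let Y : Ω → ℝ → EuclideanSpace ℝ (Fin d) := fun ω' t =>
    volterraSolution hA hAC (toPath (V ω')) t.toNNReal
  have hYc : ∀ ω', ContinuousOn (Y ω') (Ici 0) := fun ω' =>
    ((map_continuous _).comp continuous_real_toNNReal).continuousOn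
  have hYpath : ∀ ω', toPath (Y ω') = volterraSolution hA hAC (toPath (V ω')) := fun ω' => by
    ext1 t
    rw [toPath_apply (hYc ω')]
    simp only [Y, Real.toNNReal_coe]
  refine ⟨Y, hYc, fun ω' t ht => ?_, fun hcomm ω' t ht => ?_, fun P _ hP => ?_⟩
  · have := congrArg (fun y : C(ℝ≥0, EuclideanSpace ℝ (Fin d)) => y t.toNNReal)
      (volterraSolution_eq hA hAC (toPath (V ω')))
    simp only [ContinuousMap.add_apply, toPath_apply (hVc ω'), volterraMap, ContinuousMap.coe_mk,
      Real.coe_toNNReal t ht] at this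
    refine this.trans (congrArg (V ω' t + ·) (intervalIntegral.integral_congr fun s hs => ?_))
    rw [uIcc_of_le ht] at hs
    simp only [hAeq s hs.1, Y]
  · have := volterraSolution_eq_of_commute hA hAC
      (fun s t => hcomm _ _ (le_max_right s 0) (le_max_right t 0)) (toPath (V ω')) t.toNNReal
    rw [toPath_apply (hVc ω'), Real.coe_toNNReal t ht] at this
    refine this.trans (congrArg (V ω' t + ·) (intervalIntegral.integral_congr fun s hs => ?_))
    rw [uIcc_of_le ht] at hs
    have e : ∫ r in s..t, A r = ∫ r in s..t, fderiv ℝ fbar (W r) :=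
      intervalIntegral.integral_congr fun r hr => by
        rw [uIcc_of_le hs.2] at hr
        exact hAeq r (hs.1.trans hr.1)
    simp only [hAeq s hs.1, e, toPath_apply (hVc ω'), Real.coe_toNNReal s hs.1]
  · have h : FunctionalLLN φ ν P a Z ℙ := fun g hg T => hFLLN g hg T P hP
    -- a bounded density of integral `1`, whose occupation integrals converge to `Z`
    obtain ⟨B, hB, hB0, hBfin⟩ := exists_measurableSet_lt_measure hν 0
    rw [Nat.cast_zero] at hB0
    let g : M → ℝ := B.indicator fun _ => (ν.real B)⁻¹
    have hgm : Measurable g := measurable_const.indicator hB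
    have hg : Integrable g ν := (integrable_indicator_iff hB).2 (integrableOn_const hBfin.ne)
    have hgn : ∀ ω, ‖g ω‖ ≤ ‖(ν.real B)⁻¹‖ := fun ω =>
      norm_indicator_le_norm_self (fun _ => (ν.real B)⁻¹) ω
    have hg1 : ∫ ω, g ω ∂ν = 1 := by
      simp only [g]
      rw [integral_indicator hB, setIntegral_const, smul_eq_mul, mul_inv_cancel₀ hB0.ne']
    let z : Ioi (0 : ℝ) → M → C(ℝ≥0, ℝ) := fun ε ω =>
      toPath fun t => a ε * ∫ s in (0 : ℝ)..(t / ε), g (φ s ω)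
    have hz : TendstoInDistribution z zeroPlus (fun ω' => toPath (Z ω')) (fun _ => P) ℙ := by
      simpa only [hg1, one_mul] using h.tendsto_path hg
    have hXm : ∀ (ε : Ioi (0 : ℝ)) t, 0 ≤ t → Measurable fun ω => X ε ω t := fun ε t ht => by
      have hm : Measurable fun p : (ℝ × M) × EuclideanSpace ℝ (Fin d) =>
          f p.2 (scaledFlow φ ε p.1.1 p.1.2) + fbar p.2 :=
        (hf.comp (measurable_snd.prodMk ((measurable_scaledFlow hφ ε.2).comp measurable_fst))).add
          (hfbar.differentiable.continuous.measurable.comp measurable_snd)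
      refine measurable_isSolution (C := C + C) (K := C + C) hm
        (fun s ω y => norm_add_le_of_le ((hf' _).bound y) (hfbar.bound y)) (by positivity)
        (fun s ω y z => ?_) (fun ω => isSolution_scaledFlow (hX ε ε.2 ω)) ht
      rw [add_sub_add_comm, add_mul]
      exact norm_add_le_of_le ((hf' _).norm_sub_le y z) (hfbar.norm_sub_le y z)
    let y : Ioi (0 : ℝ) → M → C(ℝ≥0, EuclideanSpace ℝ (Fin d)) := fun ε ω =>
      toPath fun t => (a ε / ε) • (X ε ω t - W t)
    have hyc : ∀ (ε : Ioi (0 : ℝ)) ω,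
        ContinuousOn (fun t => (a ε / (ε : ℝ)) • (X ε ω t - W t)) (Ici 0) := fun ε ω =>
      ((hX ε ε.2 ω).1.sub hW.1).const_smul (a ε / (ε : ℝ))
    have hym : ∀ ε, Measurable (y ε) := fun ε => measurable_path_of_eval fun t => by
      simp only [y, toPath_apply (hyc ε _)]
      exact ((hXm ε t t.coe_nonneg).sub_const _).const_smul (a ε / (ε : ℝ))
    -- the driving term of the linear equation satisfied by the rescaled error
    let N : Ioi (0 : ℝ) → M → C(ℝ≥0, EuclideanSpace ℝ (Fin d)) := fun ε ω =>
      y ε ω - volterraMap A hA (y ε ω)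
    have hNm : ∀ ε, Measurable (N ε) := fun ε =>
      (continuous_id.sub (continuous_volterraMap hA hAC)).measurable.comp (hym ε)
    have hN : TendstoInDistribution N zeroPlus (fun ω' => toPath (V ω')) (fun _ => P) ℙ := by
      refine tendstoInDistribution_path_of_approx (fun ε => (hNm ε).aemeasurable)
        (fun n => hz.continuous_comp
          (continuous_riemannStieltjesSum n fun i => u ((i : ℝ) / n)))
        (fun ω' => ?_) fun T η hη δ hδ => ?_
      · rw [hVeq]
        exact tendsto_riemannStieltjesSum_path hK0 hu (hZcont ω') (hZmono ω')
      · filter_upwards [h.eventually_measure_le hν hφ ha hZcont hg hgm hgn hg1 hf hC0 hf' hfbar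
          hfint hLip hW hX T hη hδ] with n hn
        filter_upwards [hn] with ε hε
        refine (measure_mono ?_).trans hε
        rintro ω ⟨t, ht, hω⟩
        refine ⟨t, ht, hω.trans (le_of_eq ?_)⟩
        rw [dist_eq_norm]
        simp only [N, y, z, Function.comp, ContinuousMap.sub_apply, toPath_apply (hyc ε ω),
          volterraMap, ContinuousMap.coe_mk]
        congr 3
        refine intervalIntegral.integral_congr fun s hs => ?_
        rw [uIcc_of_le t.coe_nonneg] at hs
        simp only [hAeq s hs.1, Real.coe_toNNReal s hs.1]
    have hfinal := hN.continuous_comp (continuous_volterraSolution hA hAC)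
    refine hfinal.congr (fun ε => ae_of_all _ fun ω => ?_) (ae_of_all _ fun ω' => ?_)
    · exact volterra_unique hA hAC (volterraSolution_eq hA hAC (N ε ω))
        (sub_add_cancel (y ε ω) (volterraMap A hA (y ε ω))).symm
    · exact (hYpath ω').symm
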